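/- **Setting.** Let the set of exponents be $E=\mathbb Z$ (discrete theory) or $E=\mathbb R$ (continuous theory). For $a\in E$ let $\lfloor a\rceil!=\Gamma(a+1)$ if $a\notin\{-1,-2,\dots\}$ and $\lfloor -n\rceil!=(-1)^{n-1}/(n-1)!$ for $n\ge1$. *Operators.* $\Lambda^+$ is the algebra of Artinian operators $f(D)=\sum_{a\in E}c_aD^a$ ($c_a\in\mathbb C$, well-ordered support), and $\Lambda\subset\Lambda^+$ the algebra of differential operators $\sum_{n\ge0,\,n\in\mathbb Z}c_nD^n$. A delta operator is an Artinian operator of degree one, i.e. with lowest term $cD$, $c\ne0$. If $f=cD^d(1+u)\neq0$ with $c\ne0$ and $u$ of positive degree, put $f^{a;n}=e^{a(\log c+2\pi i n)}D^{ad}\sum_{k\ge0}\binom ak u^k$ for $a\in E$, $n\in\mathbb Z$ (for $E=\mathbb Z$ this is the ordinary power $f^a$). *Logarithmic series.* For a finitely supported integer sequence $\alpha$, $\mathcal I^\alpha$ is the space of formal series $\sum_{a\in E}c_a\lambda^\alpha_a$ in the harmonic logarithms $\lambda_a^\alpha$ whose support is well ordered for $\ge$; for $\alpha=(0)$ one has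 $\lambda^{(0)}_a=0$ for $a=-1,-2,\dots$, and only the other exponents occur. $\mathcal I=\bigoplus_\alpha\mathcal I^\alpha$ and $\mathcal I^+=\bigoplus_{\alpha\ne(0)}\mathcal I^\alpha$. Operators act on $\mathcal I^\alpha$, $\alpha\neq(0)$, by $D^b\lambda^\alpha_a=\frac{\lfloor a\rceil!}{\lfloor a-b\rceil!}\lambda^\alpha_{a-b}$, and $\langle p\rangle_\alpha$ is the coefficient of $\lambda^\alpha_0$ in $p$. Spaces of series carry the final topology for the inclusions of the spaces of series supported in a fixed well-ordered set, the latter with coefficientwise convergence, $\mathbb C$ being discrete (for $E=\mathbb Z$: the topology given by the degree). An operator on $\mathcal I$ or $\mathcal I^+$ is called continuous if it is continuous on each $\mathcal I^\alpha$, and regular if it commutes with all skip operators $E_{\alpha\beta}:\lambda_a^\gamma\mapsto\delta_{\beta\gamma}\lambda_a^\alpha$ with $\beta\ne(0)$ or $\alpha=\beta$. *Roman shifts.* A graded sequence is a family $p_a^\alpha\in\mathcal I^\alpha$ ($a \in E$) such that $p_a^\alpha$ has degree $a$ (and $p_a^{(0)}=0$ for negative integers $a$), which is regular ($p^\alpha_a=E_{\alpha\beta}p^\beta_a$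 for $\beta\neq(0)$), and such that for $\alpha\neq(0)$ and each $s\in E$ the coefficient of $\lambda^\alpha_{a-s}/\lfloor a-s\rceil!$ in $p^\alpha_a/\lfloor a\rceil!$ is continuous in $a$ (void for $E=\mathbb Z$). It is a Roman graded sequence if for all $\alpha\neq(0)$, $a\in E$ and $f,g\in\Lambda^+$ $$\langle f(D)g(D)p_a^\alpha\rangle_\alpha=\sum_{b\in E}\frac{\lfloor a\rceil!}{\lfloor b\rceil!\,\lfloor a-b\rceil!}\langle f(D)p_b^\alpha\rangle_\alpha\langle g(D)p_{a-b}^\alpha\rangle_\alpha ,$$ with only finitely many nonzero terms. A Roman shift is an operator $\theta$, linear and continuous on each $\mathcal I^\alpha$, such that for some Roman graded sequence $\theta p_a^\alpha=p^\alpha_{a+1}$ for $a\ne-1$ and $\theta p_{-1}^\alpha=0$, for all $\alpha$. *Adjoints and derivations.* The adjoint of a regular continuous linear operator $\theta$ is the operator $\theta^*$ on $\Lambda^+$ with $\langle(\theta^*f(D))p\rangle_\alpha=\langle f(D)\theta p\rangle_\alpha$ for all $\alpha\ne(0)$, $p\in\mathcal I^\alpha$, $f\in\Lambda^+$. For a subalgebra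 $L\subseteq\Lambda^+$, an operator $Q$ on $\Lambda^+$ is a continuous, everywhere-defined Artinian derivation of $L$ if $Q(L)\subseteq L$, $Q|_L$ is continuous, and for all nonzero $f,g\in L$, all $a,b\in E$ and $n,m\in\mathbb Z$, $$Q(f^{a;n}g^{b;m})=a\,(Qf)\,f^{a-1;n}g^{b;m}+b\,(Qg)\,f^{a;n}g^{b-1;m};$$ the powers need not lie in $L$. **Proposition.** In the discrete theory and in the continuous theory: 1. A regular continuous linear operator $\theta$ on $\mathcal I^+$ is a Roman shift if and only if $\theta^*$ is a continuous, everywhere-defined Artinian derivation of $\Lambda^+$ such that $\theta^*f(D)=1$ for some delta operator $f(D)\in\Lambda^+$. 2. A regular continuous linear operator $\theta$ on $\mathcal I$ is a Roman shift if and only if $\theta^*$ is a continuous, everywhere-defined Artinian derivation of $\Lambda$ such that $\theta^*f(D)=1$ for some delta operator $f(D)\in\Lambda$. -/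

import Mathlib

open scoped DirectSum
open Topology

noncomputable section

namespace LogAlgebra

/-- `a` is one of the numbers `-1, -2, -3, …`. -/
def IsNegInt {R : Type*} [Ring R] (a : R) : Prop := ∃ n : ℕ, a = -((n : R) + 1)

open Classical in
/-- The Roman factorial `⌊a⌉!` of a real number: `Γ(a+1)`, except that
`⌊-(n+1)⌉! = (-1)^n / n!` for a natural number `n`. -/
def romanFactorialReal (a : ℝ) : ℝ :=
  if IsNegInt a then (-1) ^ (⌊-a⌋₊ - 1) / ((⌊-a⌋₊ - 1).factorial : ℝ)
  else Real.Gamma (a + 1)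

/-- The topology of formal series over a linearly ordered set of exponents: the final topology with
respect to the inclusions of the spaces `ℂ^S`, for `S` well ordered, each with the product of the
discrete topologies. So series with supports in a common well-ordered set converge when each
coefficient is eventually constant. For integer exponents this is the topology given by the
order of a Laurent series. -/
abbrev seriesTopology (E : Type*) [LinearOrder E] : TopologicalSpace (HahnSeries E ℂ) :=
  open Classical in
  ⨆ S : {S : Set E // S.IsPWO},
    TopologicalSpace.coinduced
      (fun c : S.1 → ℂ =>
        (⟨fun a => if h : a ∈ S.1 then c ⟨a, h⟩ else 0,
          S.2.mono (fun a ha => by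
            by_contra h
            exact ha (dif_neg h))⟩ : HahnSeries E ℂ))
      (@Pi.topologicalSpace S.1 (fun _ => ℂ) (fun _ => ⊥))

/-- The indices `α = (α₁, α₂, …)` of the harmonic logarithms: finitely supported integer sequences;
`(0)` is `0`. -/
abbrev LogIndex := ℕ →₀ ℤ

section

/- The exponents: `E = ℤ` in the discrete theory, `E = ℝ` in the continuous theory. -/
variable (E : Type) [CommRing E] [LinearOrder E] [IsStrictOrderedRing E] [Algebra E ℝ]

variable {E} in
/-- An exponent as a complex number. -/
def expC (a : E) : ℂ := ((algebraMap E ℝ a : ℝ) : ℂ)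

variable {E} in
/-- The Roman factorial `⌊a⌉!` of an exponent. -/
def romanFactorial (a : E) : ℂ := ((romanFactorialReal (algebraMap E ℝ a) : ℝ) : ℂ)

variable {E} in
/-- The Roman coefficient `⌊a⌉! / (⌊b⌉! ⌊a-b⌉!)`. -/
def romanCoeff (a b : E) : ℂ := romanFactorial a / (romanFactorial b * romanFactorial (a - b))

/-! ### Artinian operators -/

/-- `Λ⁺`: the algebra of Artinian operators `∑ c_a D^a`, with well-ordered support. -/
abbrev ArtinianOp := HahnSeries E ℂ

/-- `Λ`: the algebra of differential operators `∑_{n ∈ ℕ} c_n D^n`, as a subring of `Λ⁺`. -/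
def differentialOps : Subring (ArtinianOp E) := (HahnSeries.ofPowerSeries E ℂ).range

variable {E}

/-- A delta operator is an Artinian operator of degree one: its lowest term is `c D` with
`c ≠ 0`. -/
def IsDelta (f : ArtinianOp E) : Prop := f.coeff 1 ≠ 0 ∧ ∀ a < 1, f.coeff a = 0

/-- The power `f^{a;n}`. Write `f = c D^d (1 + u)` with `c ≠ 0` and `u` of positive degree; then
`f^{a;n} = exp (a (log c + 2πin)) D^{ad} ∑_k (a choose k) u^k`, with the principal logarithm.
For an integer `a` it is the usual power, for every `n`. Only used for `f ≠ 0`. -/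
def artPow (f : ArtinianOp E) (a : E) (n : ℤ) : ArtinianOp E :=
  HahnSeries.single (a * f.order)
      (Complex.exp (expC a * (Complex.log f.leadingCoeff + 2 * Real.pi * Complex.I * n))) *
    PowerSeries.heval (HahnSeries.single (-f.order) (f.leadingCoeff)⁻¹ * f - 1)
      (PowerSeries.mk fun k => Ring.choose (expC a) k)

/-- `Q` restricts to a continuous Artinian derivation, defined everywhere, of the
algebra `L ⊆ Λ⁺`. The power `f^{a;n}` of an element `f` of `L` may lie outside `L`. -/
def IsContinuousArtinianDerivation (L : Subring (ArtinianOp E))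
    (Q : ArtinianOp E →ₗ[ℂ] ArtinianOp E) : Prop :=
  (∀ f ∈ L, Q f ∈ L) ∧
  Continuous[TopologicalSpace.induced Subtype.val (seriesTopology E), seriesTopology E]
    (fun f : L => Q f.1) ∧
  ∀ f ∈ L, ∀ g ∈ L, f ≠ 0 → g ≠ 0 → ∀ (a b : E) (n m : ℤ),
    Q (artPow f a n * artPow g b m) =
      expC a • (Q f * (artPow f (a - 1) n * artPow g b m)) +
      expC b • (Q g * (artPow f a n * artPow g (b - 1) m))

/-! ### Formal power series of logarithmic type -/

variable (E) in
/-- `I^α`: the formal series `∑ c_a λ_a^α` with no infinite strictly increasing sequence of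
exponents in the support; `λ_a^α` is `single (toDual a) 1`. For `α = (0)`, where `λ_a^(0) = x^a`
and `λ_a^(0) = 0` for every negative integer `a`, only the other exponents occur. -/
def LogSpace (α : LogIndex) : Submodule ℂ (HahnSeries Eᵒᵈ ℂ) where
  carrier := {p | α = 0 → ∀ a : E, IsNegInt a → p.coeff (OrderDual.toDual a) = 0}
  zero_mem' := by intro _ a _; simp
  add_mem' := by
    intro p q hp hq h a ha
    simp [hp h a ha, hq h a ha]
  smul_mem' := by
    intro c p hp h a ha
    simp [hp h a ha]

/-- The coefficient `[λ_a^α] p`. -/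
def lcoeff {α : LogIndex} (p : LogSpace E α) (a : E) : ℂ := p.1.coeff (OrderDual.toDual a)

/-- `⟨p⟩_α`, the coefficient of `λ_0^α`. -/
def aug {α : LogIndex} (p : LogSpace E α) : ℂ := lcoeff p 0

/-- The linear bijection `λ_a ↦ ⌊a⌉! D^{-a}` from formal series in the `λ_a` onto `Λ⁺`. -/
def toArtinian (p : HahnSeries Eᵒᵈ ℂ) : ArtinianOp E where
  coeff c := romanFactorial (-c) * p.coeff (OrderDual.toDual (-c))
  isPWO_support' := by
    refine (p.isPWO_support.image_of_monotone (f := fun a : Eᵒᵈ => -(OrderDual.ofDual a))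
      (fun a b h => neg_le_neg h)).mono ?_
    intro c hc
    exact ⟨OrderDual.toDual (-c), right_ne_zero_of_mul hc, by simp⟩

/-- The inverse `D^c ↦ λ_{-c} / ⌊-c⌉!` of `toArtinian`. -/
def ofArtinian (q : ArtinianOp E) : HahnSeries Eᵒᵈ ℂ where
  coeff b := q.coeff (-(OrderDual.ofDual b)) / romanFactorial (OrderDual.ofDual b)
  isPWO_support' := by
    refine (q.isPWO_support.image_of_monotone (f := fun c : E => OrderDual.toDual (-c))
      (fun a b h => OrderDual.toDual_le_toDual.2 (neg_le_neg h))).mono ?_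
    intro b hb
    exact ⟨-(OrderDual.ofDual b), (div_ne_zero_iff.1 hb).1, by simp⟩

/-- The action of `f(D) ∈ Λ⁺` on formal series in the `λ_a^α`, `α ≠ (0)`, which is
`D^b λ_a = (⌊a⌉! / ⌊a-b⌉!) λ_{a-b}` on monomials. -/
def act (f : ArtinianOp E) (p : HahnSeries Eᵒᵈ ℂ) : HahnSeries Eᵒᵈ ℂ :=
  ofArtinian (f * toArtinian p)

/-- The action of `f(D) ∈ Λ⁺` on `I^α`, `α ≠ (0)`. -/
def actLog (f : ArtinianOp E) {α : LogIndex} (hα : α ≠ 0) (p : LogSpace E α) : LogSpace E α :=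
  ⟨act f p.1, fun h => absurd h hα⟩

open Classical in
/-- The relabelling `λ_a ↦ λ_a^α` into `I^α`; for `α = (0)` the `λ_a` with `a` a negative integer
are sent to `0`. -/
def relabel (α : LogIndex) : HahnSeries Eᵒᵈ ℂ →ₗ[ℂ] LogSpace E α where
  toFun p := ⟨⟨fun a => if α = 0 ∧ IsNegInt (OrderDual.ofDual a) then 0 else p.coeff a,
      p.isPWO_support.mono (fun a ha => by
        by_contra h
        apply ha
        have h0 : p.coeff a = 0 := by simpa using h
        simp [h0])⟩,
    fun h a ha => if_pos ⟨h, ha⟩⟩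
  map_add' p q := by
    ext a
    by_cases h : α = 0 ∧ IsNegInt (OrderDual.ofDual a) <;> simp [h]
  map_smul' c p := by
    ext a
    by_cases h : α = 0 ∧ IsNegInt (OrderDual.ofDual a) <;> simp [h]

variable (E) in
/-- The direct sum of the `I^α`, `α ∈ J`. -/
abbrev LogSum (J : Set LogIndex) := ⨁ α : J, LogSpace E α.1

variable (E) in
/-- `I⁺`, the direct sum of the `I^α` with `α ≠ (0)`. -/
abbrev LogAlgPlus := LogSum E {α | α ≠ 0}

variable (E) in
/-- The logarithmic algebra `I`, the direct sum of all `I^α` (as a vector space). -/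
abbrev LogAlg := LogSum E Set.univ

variable {J : Set LogIndex}

/-- The skip operator `E_{αβ}`: `λ_a^β ↦ λ_a^α`, and `λ_a^γ ↦ 0` for `γ ≠ β`. -/
def skip (α β : J) : LogSum E J →ₗ[ℂ] LogSum E J :=
  DirectSum.lof ℂ J (fun α => LogSpace E α.1) α ∘ₗ relabel α.1 ∘ₗ
    (LogSpace E β.1).subtype ∘ₗ DirectSum.component ℂ J (fun α => LogSpace E α.1) β

/-- A linear operator is regular if it commutes with the skip operators `E_{αβ}`, `β ≠ (0)`, and
with the projections `E_{αα}`. -/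
def IsRegularOperator (θ : LogSum E J →ₗ[ℂ] LogSum E J) : Prop :=
  ∀ α β : J, (β.1 ≠ 0 ∨ α = β) → θ ∘ₗ skip α β = skip α β ∘ₗ θ

/-- The component `I^α → I^β` of an operator. -/
def component (θ : LogSum E J →ₗ[ℂ] LogSum E J) (α β : J) :
    LogSpace E α.1 →ₗ[ℂ] LogSpace E β.1 :=
  DirectSum.component ℂ J (fun α => LogSpace E α.1) β ∘ₗ θ ∘ₗ
    DirectSum.lof ℂ J (fun α => LogSpace E α.1) α

/-- Continuity on each `I^α`. -/
def IsContinuousOperator (θ : LogSum E J →ₗ[ℂ] LogSum E J) : Prop :=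
  ∀ α β : J, Continuous[TopologicalSpace.induced Subtype.val (seriesTopology Eᵒᵈ),
    TopologicalSpace.induced Subtype.val (seriesTopology Eᵒᵈ)] (component θ α β)

/-! ### Roman graded sequences, Roman shifts, adjoints -/

/-- A graded sequence `p_a^α ∈ I^α`: it has degree `a` (and is `0` where `λ_a^α = 0`), it is
regular, and in the basis `λ_b^α / ⌊b⌉!` the coefficients of `p_a^α / ⌊a⌉!` depend continuously on
`a`. The last condition is void for integer exponents. -/
structure IsGradedSequence [TopologicalSpace E] (p : (α : J) → E → LogSpace E α.1) : Prop where
  zero : ∀ (α : J) (a : E), α.1 = 0 → IsNegInt a → p α a = 0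
  degree : ∀ (α : J) (a : E), ¬ (α.1 = 0 ∧ IsNegInt a) →
    lcoeff (p α a) a ≠ 0 ∧ ∀ b > a, lcoeff (p α a) b = 0
  regular : ∀ (α β : J) (a : E), β.1 ≠ 0 → p α a = relabel α.1 (p β a).1
  continuous : ∀ (α : J), α.1 ≠ 0 → ∀ s : E,
    Continuous fun a : E => lcoeff (p α a) (a - s) * romanFactorial (a - s) / romanFactorial a

/-- A Roman graded sequence is a graded sequence of binomial type:
`⟨f(D) g(D) p_a⟩ = ∑_b ⌊a, b⌉ ⟨f(D) p_b⟩ ⟨g(D) p_{a-b}⟩`, a sum with finitely many nonzero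
terms, for all Artinian operators `f`, `g`. -/
structure IsRomanSequence [TopologicalSpace E] (p : (α : J) → E → LogSpace E α.1) : Prop where
  graded : IsGradedSequence p
  finite_support : ∀ (α : J) (hα : α.1 ≠ 0) (f g : ArtinianOp E) (a : E),
    (Function.support fun b : E => romanCoeff a b * aug (actLog f hα (p α b)) *
      aug (actLog g hα (p α (a - b)))).Finite
  binomial : ∀ (α : J) (hα : α.1 ≠ 0) (f g : ArtinianOp E) (a : E),
    aug (actLog (f * g) hα (p α a)) =
      ∑ᶠ b : E, romanCoeff a b * aug (actLog f hα (p α b)) * aug (actLog g hα (p α (a - b)))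

open Classical in
/-- `θ` is the Roman shift `σ_p` relative to a Roman graded sequence `p`:
`θ p_a = p_{a+1}` for `a ≠ -1`, and `θ p_{-1} = 0`. (Its linearity and its continuity on
each `I^α` are stated separately.) -/
def IsRomanShift [TopologicalSpace E] (θ : LogSum E J →ₗ[ℂ] LogSum E J) : Prop :=
  ∃ p : (α : J) → E → LogSpace E α.1, IsRomanSequence p ∧ ∀ (α : J) (a : E),
    θ (DirectSum.lof ℂ J (fun α => LogSpace E α.1) α (p α a)) =
      if a = -1 then 0 else DirectSum.lof ℂ J (fun α => LogSpace E α.1) α (p α (a + 1))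

/-- `Q` is the adjoint `θ*` of the regular operator `θ`: `⟨[θ* f(D)] p⟩_α = ⟨f(D) θ p⟩_α` for all
`α ≠ (0)`, `p ∈ I^α` and `f(D) ∈ Λ⁺`. -/
def IsAdjoint (θ : LogSum E J →ₗ[ℂ] LogSum E J) (Q : ArtinianOp E →ₗ[ℂ] ArtinianOp E) : Prop :=
  ∀ (α : J) (hα : α.1 ≠ 0) (f : ArtinianOp E) (p : LogSpace E α.1),
    aug (actLog (Q f) hα p) = aug (actLog f hα (component θ α α p))

end

end LogAlgebra

end

/-! For `α ≠ (0)` the map `λ_a ↦ ⌊a⌉! D^{-a}` identifies `I^α` with `Λ⁺`, and `⟨f(D) p⟩` becomes the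
coefficient of `D^0` in a product. Continuous functionals on `I^α` are exactly these pairings, so a
continuous operator has a unique adjoint; a regular operator is determined by its action on one
`I^β`, `β ≠ (0)`. Everything thus becomes residue calculus in `Λ⁺`: the Euler operator `D^a ↦ a D^a`
is a derivation whose values have no `D^0` term, which gives integration by parts
(`euler_mul_coeff_zero`).

In both directions the adjoint turns out to be `Q = q * euler` with `q = Q(D) D⁻¹`. The power rule
on the monomials `D^a` suffices for this, since the existence of the adjoint supplies the passage to
infinite sums (`adjoint_eq_mul_euler`).

From derivation to shift: `Q f = 1` says that `q` is inverse to `euler f`. The operators `f^{-a-1}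
euler f` are biorthogonal to the powers of `f` (`dualPow_coeff_zero`, a form of Lagrange inversion).
Every operator therefore expands in powers of `f`, the Roman identity is multiplication of such
expansions (`mul_mul_dualPow_coeff`), and integration by parts shows that `θ` shifts the sequence
`⌊a⌉! f^{-a-1} euler f`.

From shift to derivation: for a Roman sequence, `f ↦ ∑_a (⟨f(D) p_a⟩ / ⌊a⌉!) D^a` is an injective,
order-preserving algebra homomorphism carrying `Q` to `d/dD`, so `Q` is a derivation. The power rule
for `D^a` follows over `ℤ` from additivity of the logarithmic derivative. Over `ℝ` the continuity of
the coefficients makes the transforms of the `D^x` binomial powers, up to monomials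
(`eq_binPow_of_continuous`). A delta operator with `Q f = 1` is then found by solving `euler f =
q⁻¹`.

On all of `I`, the index `(0)` accounts for `Λ`: since `λ_{-1}` vanishes there, `Q(D)` can only
contain natural powers of `D` (`apply_single_one_mem_differentialOps`). -/

set_option linter.unusedSectionVars false

noncomputable section

open scoped DirectSum
open Topology
open scoped Pointwise

namespace LogAlgebra

section Hahn

variable {E : Type} [CommRing E] [LinearOrder E] [IsStrictOrderedRing E] [Algebra E ℝ]

/-! ### Exponents as complex numbers -/

@[simp] lemma expC_zero : expC (0 : E) = 0 := by simp [expC]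
@[simp] lemma expC_one : expC (1 : E) = 1 := by simp [expC]
@[simp] lemma expC_add (a b : E) : expC (a + b) = expC a + expC b := by simp [expC]
@[simp] lemma expC_sub (a b : E) : expC (a - b) = expC a - expC b := by simp [expC]
@[simp] lemma expC_neg (a : E) : expC (-a) = -expC a := by simp [expC]
@[simp] lemma expC_mul (a b : E) : expC (a * b) = expC a * expC b := by simp [expC]
@[simp] lemma expC_natCast (n : ℕ) : expC (n : E) = n := by simp [expC]

lemma expC_injective [FaithfulSMul E ℝ] : Function.Injective (expC : E → ℂ) := fun _ _ h =>
  FaithfulSMul.algebraMap_injective E ℝ (Complex.ofReal_injective h)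

lemma expC_eq_zero [FaithfulSMul E ℝ] {a : E} : expC a = 0 ↔ a = 0 :=
  ⟨fun h => expC_injective (h.trans expC_zero.symm), fun h => by simp [h]⟩

/-! ### Scalars and sums of summable families -/

lemma smul_mul_hahn (c : ℂ) (f g : ArtinianOp E) : (c • f) * g = c • (f * g) := by
  rw [← HahnSeries.C_mul_eq_smul, ← HahnSeries.C_mul_eq_smul, mul_assoc]

lemma mul_smul_hahn (c : ℂ) (f g : ArtinianOp E) : f * (c • g) = c • (f * g) := by
  rw [mul_comm, smul_mul_hahn, mul_comm]

lemma mul_hsum_coeff {ι : Type*} (f : ArtinianOp E) (s : HahnSeries.SummableFamily E ℂ ι) (t : E) :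
    (f * s.hsum).coeff t = ∑ᶠ i, (f * s i).coeff t := by
  rw [← HahnSeries.SummableFamily.hsum_smul, HahnSeries.SummableFamily.coeff_hsum]
  exact finsum_congr fun i => by
    rw [HahnSeries.SummableFamily.smul_apply, HahnSeries.of_symm_smul_of_eq_mul]

lemma finite_support_mul_coeff {ι : Type*} (f : ArtinianOp E)
    (s : HahnSeries.SummableFamily E ℂ ι) (t : E) :
    (Function.support fun i => (f * s i).coeff t).Finite := by
  have h : (Function.support fun i => ((f • s) i).coeff t).Finite := (f • s).finite_co_support t
  simpa only [HahnSeries.SummableFamily.smul_apply, HahnSeries.of_symm_smul_of_eq_mul] using h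

/-! ### The Euler operator -/

/-- The Euler operator `D^a ↦ a D^a`, a derivation of `Λ⁺`. -/
def euler : ArtinianOp E →ₗ[ℂ] ArtinianOp E where
  toFun f :=
    { coeff := fun a => expC a * f.coeff a
      isPWO_support' := f.isPWO_support.mono fun _ ha => right_ne_zero_of_mul ha }
  map_add' f g := by ext a; simp [mul_add]
  map_smul' c f := by ext a; simp [mul_left_comm]

@[simp] lemma euler_coeff (f : ArtinianOp E) (a : E) :
    (euler f).coeff a = expC a * f.coeff a := rfl

lemma support_euler (f : ArtinianOp E) : (euler f).support ⊆ f.support :=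
  fun _ ha => right_ne_zero_of_mul ha

lemma euler_mul (f g : ArtinianOp E) : euler (f * g) = euler f * g + f * euler g := by
  ext a
  rw [HahnSeries.coeff_add, euler_coeff,
    HahnSeries.coeff_mul, HahnSeries.coeff_mul_left' f.isPWO_support (support_euler f),
    HahnSeries.coeff_mul_right' g.isPWO_support (support_euler g), Finset.mul_sum,
    ← Finset.sum_add_distrib]
  refine Finset.sum_congr rfl fun ij hij => ?_
  rw [← (Finset.mem_antidiagonal.1 hij).2.2, euler_coeff, euler_coeff, expC_add]
  ring

@[simp] lemma euler_one : euler (1 : ArtinianOp E) = 0 := by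
  have h := euler_mul (1 : ArtinianOp E) 1
  simpa using h

lemma euler_pow_succ (f : ArtinianOp E) (n : ℕ) :
    euler (f ^ (n + 1)) = ((n : ℂ) + 1) • (f ^ n * euler f) := by
  induction n with
  | zero => simp
  | succ n ih =>
    rw [pow_succ, euler_mul, ih, smul_mul_hahn]
    push_cast
    simp only [← HahnSeries.C_mul_eq_smul, map_add, map_one]
    ring

@[simp] lemma euler_single (a : E) (c : ℂ) :
    euler (HahnSeries.single a c) = expC a • HahnSeries.single a c := by
  ext b
  rcases eq_or_ne b a with rfl | h <;> simp [*]

lemma euler_coeff_zero (f : ArtinianOp E) : (euler f).coeff 0 = 0 := by simp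

/-- Integration by parts, with the coefficient of `D^0` as residue. -/
lemma euler_mul_coeff_zero (f g : ArtinianOp E) :
    (euler f * g).coeff 0 = -(f * euler g).coeff 0 := by
  have h := euler_coeff_zero (f * g)
  rw [euler_mul, HahnSeries.coeff_add] at h
  exact eq_neg_of_add_eq_zero_left h

/-! ### Binomial powers -/

/-- The binomial power `(1 + u)^a`, for `u` of positive degree. -/
def binPow (u : ArtinianOp E) (a : E) : ArtinianOp E :=
  PowerSeries.heval u (PowerSeries.mk fun k => Ring.choose (expC a) k)

lemma binPow_eq (u : ArtinianOp E) (a : E) :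
    binPow u a = PowerSeries.heval u (PowerSeries.binomialSeries ℂ (expC a)) := by
  simp [binPow, PowerSeries.binomialSeries]

lemma binPow_add (u : ArtinianOp E) (a b : E) : binPow u (a + b) = binPow u a * binPow u b := by
  simp [binPow_eq, -PowerSeries.heval_apply]

@[simp] lemma binPow_zero (u : ArtinianOp E) : binPow u 0 = 1 := by
  simp [binPow_eq, -PowerSeries.heval_apply]

lemma binPow_natCast {u : ArtinianOp E} (hu : 0 < u.orderTop) (n : ℕ) :
    binPow u n = (1 + u) ^ n := by
  simp [binPow_eq, PowerSeries.heval_X u hu, -PowerSeries.heval_apply]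

lemma binPow_one {u : ArtinianOp E} (hu : 0 < u.orderTop) : binPow u 1 = 1 + u := by
  simpa using binPow_natCast hu 1

lemma binPow_coeff {u : ArtinianOp E} (hu : 0 < u.orderTop) (a t : E) :
    (binPow u a).coeff t = ∑ᶠ k : ℕ, Ring.choose (expC a) k * (u ^ k).coeff t := by
  simp [binPow, hu, HahnSeries.SummableFamily.coeff_hsum]

lemma binPow_coeff_zero (u : ArtinianOp E) (a : E) : (binPow u a).coeff 0 = 1 := by
  rw [binPow, PowerSeries.coeff_heval_zero]
  simp [← PowerSeries.coeff_zero_eq_constantCoeff_apply]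

lemma finite_pow_coeff_ne_zero {u : ArtinianOp E} (hu : 0 < u.orderTop) (t : E) :
    {k : ℕ | (u ^ k).coeff t ≠ 0}.Finite :=
  HahnSeries.SummableFamily.pow_finite_co_support hu t

/-- The finite index set does not depend on `a`, so continuity in `a` can be checked termwise. -/
lemma binPow_coeff_eq_sum {u : ArtinianOp E} (hu : 0 < u.orderTop) (a t : E) :
    (binPow u a).coeff t = ∑ k ∈ (finite_pow_coeff_ne_zero hu t).toFinset,
      Ring.choose (expC a) k * (u ^ k).coeff t := by
  rw [binPow_coeff hu]
  refine finsum_eq_sum_of_support_subset _ fun k hk => ?_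
  simpa using right_ne_zero_of_mul hk

/-- The additive monoid generated by the support of `u` contains the supports of all the
powers `(1 + u)^a`. -/
def powSupport (u : ArtinianOp E) : Set E := AddSubmonoid.closure u.support

lemma pos_of_mem_support {u : ArtinianOp E} (hu : 0 < u.orderTop) {t : E} (ht : t ∈ u.support) :
    0 < t := by
  have := hu.trans_le (HahnSeries.orderTop_le_of_coeff_ne_zero ht)
  exact_mod_cast this

lemma powSupport_isPWO {u : ArtinianOp E} (hu : 0 < u.orderTop) : (powSupport u).IsPWO :=
  u.isPWO_support.addSubmonoid_closure fun _ ht => (pos_of_mem_support hu ht).le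

lemma powSupport_nonneg {u : ArtinianOp E} (hu : 0 < u.orderTop) {t : E}
    (ht : t ∈ powSupport u) : 0 ≤ t := by
  refine AddSubmonoid.closure_induction (motive := fun t _ => 0 ≤ t) ?_ le_rfl ?_ ht
  · exact fun _ hx => (pos_of_mem_support hu hx).le
  · exact fun _ _ _ _ => add_nonneg

lemma support_binPow_subset {u : ArtinianOp E} (hu : 0 < u.orderTop) (a : E) :
    (binPow u a).support ⊆ powSupport u := by
  intro t ht
  rw [HahnSeries.mem_support, binPow_coeff hu] at ht
  obtain ⟨k, hk⟩ : ∃ k : ℕ, Ring.choose (expC a) k * (u ^ k).coeff t ≠ 0 := by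
    by_contra! h
    exact ht (by simp [h])
  exact HahnSeries.SummableFamily.support_pow_subset_closure u k (right_ne_zero_of_mul hk)

lemma binPow_ne_zero (u : ArtinianOp E) (a : E) : binPow u a ≠ 0 := fun h => by
  simpa [h] using binPow_coeff_zero u a

lemma ring_choose_succ_mul (a : ℂ) (k : ℕ) :
    ((k : ℂ) + 1) * Ring.choose a (k + 1) = a * Ring.choose (a - 1) k := by
  have h := Ring.choose_smul_choose a (n := k + 1) (k := 1) (by omega)
  simpa [mul_comm] using h

lemma euler_binPow {u : ArtinianOp E} (hu : 0 < u.orderTop) (a : E) :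
    euler (binPow u a) = expC a • (binPow u (a - 1) * euler u) := by
  ext t
  have h1 : (euler (binPow u a)).coeff t =
      ∑ᶠ k : ℕ, Ring.choose (expC a) k * (euler (u ^ k)).coeff t := by
    rw [euler_coeff, binPow_coeff hu, mul_finsum]
    · simp only [euler_coeff, mul_left_comm]
  have h2 : (expC a • (binPow u (a - 1) * euler u)).coeff t =
      ∑ᶠ k : ℕ, expC a * (Ring.choose (expC a - 1) k * (u ^ k * euler u).coeff t) := by
    rw [HahnSeries.coeff_smul, mul_comm, binPow, PowerSeries.heval_apply, mul_hsum_coeff,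
      smul_eq_mul, mul_finsum]
    refine finsum_congr fun k => ?_
    rw [HahnSeries.SummableFamily.powerSeriesFamily_of_orderTop_pos hu, PowerSeries.coeff_mk,
      expC_sub, expC_one, mul_smul_hahn, mul_comm (euler u), HahnSeries.coeff_smul, smul_eq_mul]
  have h3 : ∀ k : ℕ, expC a * (Ring.choose (expC a - 1) k * (u ^ k * euler u).coeff t) =
      Ring.choose (expC a) (k + 1) * (euler (u ^ (k + 1))).coeff t := by
    intro k
    rw [euler_pow_succ, HahnSeries.coeff_smul, smul_eq_mul, ← mul_assoc, ← ring_choose_succ_mul]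
    ring
  rw [h1, h2]
  simp_rw [h3]
  -- The two sums differ by the shift `k ↦ k + 1`; nothing is lost because the Euler operator kills
  -- `u ^ 0`.
  rw [← finsum_mem_range (f := fun k => Ring.choose (expC a) k * (euler (u ^ k)).coeff t)
    Nat.succ_injective, finsum_mem_def, Set.indicator_eq_self.2]
  rintro (_ | k) hk
  · simp at hk
    simp [hk.2] at hk
  · exact ⟨k, rfl⟩

/-! ### Powers of Artinian operators -/

/-- The normalized tail `u` of `f = c D^d (1 + u)`. -/
def tail (f : ArtinianOp E) : ArtinianOp E :=
  HahnSeries.single (-f.order) (f.leadingCoeff)⁻¹ * f - 1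

lemma tail_orderTop_pos {f : ArtinianOp E} (hf : f ≠ 0) : 0 < (tail f).orderTop := by
  have h1 : f.leadingCoeff ≠ 0 := HahnSeries.leadingCoeff_ne_zero.2 hf
  rw [tail, HahnSeries.orderTop_self_sub_one_pos_iff]
  constructor
  · rw [HahnSeries.orderTop_mul, HahnSeries.orderTop_single (inv_ne_zero h1),
      ← HahnSeries.order_eq_orderTop_of_ne_zero hf, ← WithTop.coe_add]
    simp
  · rw [HahnSeries.leadingCoeff_mul, HahnSeries.leadingCoeff_of_single, inv_mul_cancel₀ h1]

lemma eq_single_mul_one_add_tail {f : ArtinianOp E} (hf : f ≠ 0) :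
    f = HahnSeries.single f.order f.leadingCoeff * (1 + tail f) := by
  rw [tail, add_sub_cancel, ← mul_assoc, HahnSeries.single_mul_single, add_neg_cancel,
    mul_inv_cancel₀ (HahnSeries.leadingCoeff_ne_zero.2 hf), HahnSeries.single_zero_one, one_mul]

/-- The scalar `exp (a (log c + 2πin))` of the power `f^{a;n}`. -/
def powScalar (f : ArtinianOp E) (a : E) (n : ℤ) : ℂ :=
  Complex.exp (expC a * (Complex.log f.leadingCoeff + 2 * Real.pi * Complex.I * n))

lemma powScalar_ne_zero (f : ArtinianOp E) (a : E) (n : ℤ) : powScalar f a n ≠ 0 :=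
  Complex.exp_ne_zero _

lemma powScalar_add (f : ArtinianOp E) (a b : E) (n : ℤ) :
    powScalar f (a + b) n = powScalar f a n * powScalar f b n := by
  rw [powScalar, expC_add, add_mul, Complex.exp_add]; rfl

@[simp] lemma powScalar_zero (f : ArtinianOp E) (n : ℤ) : powScalar f 0 n = 1 := by
  simp [powScalar]

lemma powScalar_one {f : ArtinianOp E} (hf : f ≠ 0) (n : ℤ) :
    powScalar f 1 n = f.leadingCoeff := by
  rw [powScalar, expC_one, one_mul, Complex.exp_add,
    Complex.exp_log (HahnSeries.leadingCoeff_ne_zero.2 hf), mul_comm _ (n : ℂ),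
    Complex.exp_int_mul_two_pi_mul_I, mul_one]

lemma artPow_eq (f : ArtinianOp E) (a : E) (n : ℤ) :
    artPow f a n = HahnSeries.single (a * f.order) (powScalar f a n) * binPow (tail f) a := rfl

lemma artPow_add (f : ArtinianOp E) (a b : E) (n : ℤ) :
    artPow f (a + b) n = artPow f a n * artPow f b n := by
  rw [artPow_eq, artPow_eq, artPow_eq, binPow_add, powScalar_add, add_mul,
    ← HahnSeries.single_mul_single]
  ring

@[simp] lemma artPow_zero (f : ArtinianOp E) (n : ℤ) : artPow f 0 n = 1 := by
  simp [artPow_eq]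

lemma artPow_one {f : ArtinianOp E} (hf : f ≠ 0) (n : ℤ) : artPow f 1 n = f := by
  rw [artPow_eq, powScalar_one hf, one_mul, binPow_one (tail_orderTop_pos hf),
    ← eq_single_mul_one_add_tail hf]

lemma artPow_ne_zero (f : ArtinianOp E) (a : E) (n : ℤ) : artPow f a n ≠ 0 :=
  mul_ne_zero (HahnSeries.single_ne_zero (powScalar_ne_zero f a n)) (binPow_ne_zero _ _)

/-- The branch `n` enters only through a scalar, so the power rule reduces to those for a monomial
and for `1 + u`. -/
lemma euler_artPow {f : ArtinianOp E} (hf : f ≠ 0) (a : E) (n : ℤ) :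
    euler (artPow f a n) = expC a • (euler f * artPow f (a - 1) n) := by
  have hu := tail_orderTop_pos hf
  have h1 : euler f = HahnSeries.single f.order f.leadingCoeff *
      (expC f.order • (1 + tail f) + euler (tail f)) := by
    conv_lhs => rw [eq_single_mul_one_add_tail hf]
    rw [euler_mul, euler_single, map_add, euler_one]
    simp only [← HahnSeries.C_mul_eq_smul]
    ring
  have h2 : HahnSeries.single (a * f.order) (powScalar f a n) =
      HahnSeries.single f.order f.leadingCoeff *
        HahnSeries.single ((a - 1) * f.order) (powScalar f (a - 1) n) := by
    rw [HahnSeries.single_mul_single, ← powScalar_one hf n, ← powScalar_add]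
    congr 2 <;> ring_nf
  have h3 : binPow (tail f) a = (1 + tail f) * binPow (tail f) (a - 1) := by
    rw [← binPow_one hu, ← binPow_add, add_sub_cancel]
  rw [h1, artPow_eq, artPow_eq, euler_mul, euler_binPow hu, euler_single, h2, h3, expC_mul]
  simp only [← HahnSeries.C_mul_eq_smul, map_mul]
  ring

end Hahn

/-! ### The topology of formal series -/

section SeriesTopology

variable {F G : Type*} [LinearOrder F] [LinearOrder G]

lemma continuous_of_finite_dependence {ι K M : Type*} [TopologicalSpace K] [DiscreteTopology K]
    [TopologicalSpace M] (g : (ι → K) → M) (A : Finset ι)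
    (h : ∀ c c' : ι → K, (∀ s ∈ A, c s = c' s) → g c = g c') : Continuous g := by
  rw [continuous_iff_continuousAt]
  intro c
  have hopen : IsOpen ((A : Set ι).pi fun s => ({c s} : Set K)) :=
    isOpen_set_pi A.finite_toSet fun _ _ => isOpen_discrete _
  refine (continuousAt_const (y := g c)).congr ?_
  filter_upwards [hopen.mem_nhds (fun s _ => rfl)] with c' hc'
  exact (h c' c hc').symm

/-- Basic neighbourhoods in a product constrain finitely many coordinates. With the preceding
converse, this turns continuity into a finiteness condition. -/
lemma exists_finite_dependence {ι K M : Type*} [TopologicalSpace K]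
    [TopologicalSpace M] [DiscreteTopology M] (g : (ι → K) → M) (hg : Continuous g) (c : ι → K) :
    ∃ A : Finset ι, ∀ c', (∀ s ∈ A, c' s = c s) → g c' = g c := by
  obtain ⟨A, u, hu, hA⟩ := isOpen_pi_iff.1 ((isOpen_discrete {g c}).preimage hg) c rfl
  refine ⟨A, fun c' hc' => hA fun s hs => ?_⟩
  rw [hc' s hs]
  exact (hu s hs).2

open Classical in
/-- The inclusion of `ℂ^S`, `S` well ordered, into the space of series. -/
def seriesOn (S : {S : Set F // S.IsPWO}) (c : S.1 → ℂ) : HahnSeries F ℂ :=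
  ⟨fun a => if h : a ∈ S.1 then c ⟨a, h⟩ else 0,
    S.2.mono fun _ ha => by_contra fun h => ha (dif_neg h)⟩

lemma seriesOn_coeff (S : {S : Set F // S.IsPWO}) (c : S.1 → ℂ) (a : S.1) :
    (seriesOn S c).coeff a = c a := dif_pos a.2

lemma seriesOn_coeff_of_notMem (S : {S : Set F // S.IsPWO}) (c : S.1 → ℂ) {a : F}
    (ha : a ∉ S.1) : (seriesOn S c).coeff a = 0 := dif_neg ha

lemma support_seriesOn (S : {S : Set F // S.IsPWO}) (c : S.1 → ℂ) :
    (seriesOn S c).support ⊆ S.1 :=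
  fun _ ha => by_contra fun h => ha (seriesOn_coeff_of_notMem S c h)

lemma seriesOn_coeff_restrict (S : {S : Set F // S.IsPWO}) {p : HahnSeries F ℂ}
    (hp : p.support ⊆ S.1) : seriesOn S (fun a => p.coeff a) = p := by
  ext a
  by_cases ha : a ∈ S.1
  · exact seriesOn_coeff S _ ⟨a, ha⟩
  · rw [seriesOn_coeff_of_notMem S _ ha]
    exact (by_contra fun h => ha (hp (Ne.symm h)))

lemma continuous_series_iff {X : Type*} [t : TopologicalSpace X] (g : HahnSeries F ℂ → X) :
    Continuous[seriesTopology F, t] g ↔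
      ∀ S : {S : Set F // S.IsPWO},
        Continuous[@Pi.topologicalSpace S.1 (fun _ => ℂ) (fun _ => ⊥), t] (g ∘ seriesOn S) := by
  rw [continuous_iSup_dom]
  exact forall_congr' fun S => continuous_coinduced_dom

lemma continuous_seriesOn (S : {S : Set F // S.IsPWO}) :
    Continuous[@Pi.topologicalSpace S.1 (fun _ => ℂ) (fun _ => ⊥), seriesTopology F]
      (seriesOn S) :=
  (@continuous_series_iff F _ _ (seriesTopology F) id).1 (@continuous_id _ (seriesTopology F)) S

/-! ### Continuous functionals as finitary functionals -/

/-- On the series supported in a well-ordered set, the functional depends on finitely many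
coefficients only. -/
def IsFinitary (l : HahnSeries F ℂ →ₗ[ℂ] ℂ) : Prop :=
  ∀ S : Set F, S.IsPWO → ∃ A : Finset F, ∀ p : HahnSeries F ℂ, p.support ⊆ S →
    (∀ s ∈ A, p.coeff s = 0) → l p = 0

lemma IsFinitary.continuous_comp {l : HahnSeries F ℂ →ₗ[ℂ] ℂ} (hl : IsFinitary l)
    {X : Type*} [TopologicalSpace X] (g : ℂ → X) (S : {S : Set F // S.IsPWO}) :
    Continuous[@Pi.topologicalSpace S.1 (fun _ => ℂ) (fun _ => ⊥), _]
      (fun c => g (l (seriesOn S c))) := by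
  classical
  obtain ⟨A, hA⟩ := hl S.1 S.2
  let _ : TopologicalSpace ℂ := ⊥
  have : DiscreteTopology ℂ := ⟨rfl⟩
  refine continuous_of_finite_dependence _ (A.subtype (· ∈ S.1)) fun c c' h => ?_
  congr 1
  rw [← sub_eq_zero, ← map_sub]
  refine hA _ ?_ fun s hs => ?_
  · intro a ha
    by_contra h'
    refine ha ?_
    rw [HahnSeries.coeff_sub, seriesOn_coeff_of_notMem S _ h', seriesOn_coeff_of_notMem S _ h',
      sub_zero]
  · rw [HahnSeries.coeff_sub]
    by_cases hs' : s ∈ S.1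
    · rw [seriesOn_coeff S c ⟨s, hs'⟩, seriesOn_coeff S c' ⟨s, hs'⟩, h ⟨s, hs'⟩ (by simpa using hs),
        sub_self]
    · rw [seriesOn_coeff_of_notMem S _ hs', seriesOn_coeff_of_notMem S _ hs', sub_zero]

lemma isFinitary_of_continuous {l : HahnSeries F ℂ →ₗ[ℂ] ℂ}
    (hl : Continuous[seriesTopology F, ⊥] l) : IsFinitary l := by
  intro S hS
  have h := (@continuous_series_iff F _ _ ⊥ l).1 hl ⟨S, hS⟩
  let _ : TopologicalSpace ℂ := ⊥
  have : DiscreteTopology ℂ := ⟨rfl⟩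
  obtain ⟨A, hA⟩ := exists_finite_dependence _ h 0
  refine ⟨A.map (Function.Embedding.subtype _), fun p hp hpA => ?_⟩
  have h1 := hA (fun a => p.coeff a) fun s hs => hpA s (by simpa using hs)
  have h2 : seriesOn ⟨S, hS⟩ (0 : S → ℂ) = 0 := by
    rw [← seriesOn_coeff_restrict ⟨S, hS⟩ (p := 0) (by simp)]
    rfl
  simpa [seriesOn_coeff_restrict ⟨S, hS⟩ hp, h2] using h1

lemma IsFinitary.continuous {l : HahnSeries F ℂ →ₗ[ℂ] ℂ} (hl : IsFinitary l) :
    Continuous[seriesTopology F, ⊥] l :=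
  (@continuous_series_iff F _ _ ⊥ l).2 fun S => @IsFinitary.continuous_comp F _ l hl ℂ ⊥ id S

lemma IsFinitary.comp {l : HahnSeries G ℂ →ₗ[ℂ] ℂ} (hl : IsFinitary l)
    {T : HahnSeries F ℂ →ₗ[ℂ] HahnSeries G ℂ}
    (hT : Continuous[seriesTopology F, seriesTopology G] T) : IsFinitary (l ∘ₗ T) :=
  isFinitary_of_continuous (@Continuous.comp _ _ _ (seriesTopology F) (seriesTopology G) ⊥ _ _
    hl.continuous hT)

lemma IsFinitary.eq_zero {l : HahnSeries F ℂ →ₗ[ℂ] ℂ} (hl : IsFinitary l)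
    (h : ∀ a, l (HahnSeries.single a 1) = 0) : l = 0 := by
  classical
  ext p
  obtain ⟨A, hA⟩ := hl p.support p.isPWO_support
  have h1 : ∀ a c, l (HahnSeries.single a c) = 0 := fun a c => by
    have : HahnSeries.single a c = c • HahnSeries.single a (1 : ℂ) := by
      ext b; simp [HahnSeries.coeff_single]
    rw [this, map_smul, h, smul_zero]
  -- On series supported in the support of `p`, `l` sees only the coefficients in `A`, so it cannot
  -- distinguish `p` from this truncation.
  have h2 : l (p - ∑ a ∈ A, HahnSeries.single a (p.coeff a)) = 0 := by
    refine hA _ (fun a ha => ?_) fun s hs => ?_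
    · by_contra hap
      have : p.coeff a = 0 := by simpa using hap
      refine ha ?_
      rw [HahnSeries.coeff_sub, this, HahnSeries.coeff_sum, Finset.sum_eq_zero, sub_zero]
      intro x _
      rcases eq_or_ne a x with rfl | hax
      · simp [this]
      · exact HahnSeries.coeff_single_of_ne hax
    · rw [HahnSeries.coeff_sub, HahnSeries.coeff_sum, Finset.sum_eq_single s
        (fun x _ hx => HahnSeries.coeff_single_of_ne hx.symm) (fun h => absurd hs h),
        HahnSeries.coeff_single_same, sub_self]
  rw [map_sub, map_sum, Finset.sum_eq_zero fun a _ => h1 a _, sub_zero] at h2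
  simpa using h2

lemma IsFinitary.sub {l m : HahnSeries F ℂ →ₗ[ℂ] ℂ} (hl : IsFinitary l) (hm : IsFinitary m) :
    IsFinitary (l - m) := by
  classical
  intro S hS
  obtain ⟨A, hA⟩ := hl S hS
  obtain ⟨B, hB⟩ := hm S hS
  refine ⟨A ∪ B, fun p hp h => ?_⟩
  rw [LinearMap.sub_apply, hA p hp fun s hs => h s (Finset.mem_union_left _ hs),
    hB p hp fun s hs => h s (Finset.mem_union_right _ hs), sub_zero]

/-- A linear map is continuous if it maps the series supported in a fixed well-ordered set to
series supported in a fixed well-ordered set, and each coefficient of the value depends on finitely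
many coefficients. -/
lemma continuous_of_isFinitary {T : HahnSeries F ℂ →ₗ[ℂ] HahnSeries G ℂ}
    (hS : ∀ S : Set F, S.IsPWO → ∃ S' : Set G, S'.IsPWO ∧
      ∀ p : HahnSeries F ℂ, p.support ⊆ S → (T p).support ⊆ S')
    (l : G → HahnSeries F ℂ →ₗ[ℂ] ℂ) (hl : ∀ a, IsFinitary (l a))
    (hT : ∀ a p, (T p).coeff a = l a p) :
    Continuous[seriesTopology F, seriesTopology G] T := by
  rw [@continuous_series_iff F _ _ (seriesTopology G)]
  intro S
  obtain ⟨S', hS', h⟩ := hS S.1 S.2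
  have h1 : T ∘ seriesOn S = seriesOn ⟨S', hS'⟩ ∘ fun c a => l a (seriesOn S c) := by
    funext c
    rw [Function.comp_apply, ← seriesOn_coeff_restrict ⟨S', hS'⟩ (h _ (support_seriesOn S c))]
    simp only [hT]
    rfl
  rw [h1]
  refine @Continuous.comp _ _ _ (@Pi.topologicalSpace S.1 (fun _ => ℂ) (fun _ => ⊥))
    (@Pi.topologicalSpace S' (fun _ => ℂ) (fun _ => ⊥)) (seriesTopology G) _ _ (continuous_seriesOn ⟨S', hS'⟩) ?_
  exact @continuous_pi _ _ _ (@Pi.topologicalSpace S.1 (fun _ => ℂ) (fun _ => ⊥)) (fun _ => ⊥) _ fun a =>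
    @IsFinitary.continuous_comp F _ (l a) (hl a) ℂ ⊥ id S

lemma isPWO_range_of_monotone {f : ℕ → F} (hf : Monotone f) : (Set.range f).IsPWO := by
  rw [← Set.image_univ]
  exact (Set.isPWO_of_wellQuasiOrderedLE Set.univ).image_of_monotone hf

lemma isPWO_of_no_strictAnti {S : Set F} (h : ∀ f : ℕ → F, StrictAnti f → (∀ n, f n ∈ S) → False) :
    S.IsPWO := by
  rw [Set.isPWO_iff_isWF, Set.isWF_iff_no_descending_seq]
  exact fun f hf hS => h f hf hS

end SeriesTopology

/-! ### Roman factorials -/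

lemma romanFactorialReal_of_neg (n : ℕ) :
    romanFactorialReal (-((n : ℝ) + 1)) = (-1) ^ n / (n.factorial : ℝ) := by
  have h : ⌊-(-((n : ℝ) + 1))⌋₊ - 1 = n := by
    rw [neg_neg, Nat.floor_add_one (Nat.cast_nonneg n), Nat.floor_natCast, Nat.add_sub_cancel]
  rw [romanFactorialReal, if_pos ⟨n, rfl⟩, h]

lemma romanFactorialReal_ne_zero (a : ℝ) : romanFactorialReal a ≠ 0 := by
  by_cases h : IsNegInt a
  · obtain ⟨n, rfl⟩ := h
    rw [romanFactorialReal_of_neg]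
    positivity
  · rw [romanFactorialReal, if_neg h]
    refine Real.Gamma_ne_zero fun m hm => h ⟨m, by linarith⟩

/-- At `a = -1` the right side would be `0` while `⌊0⌉! = 1`; this is the source of the exceptional
value `θ p_{-1} = 0`. -/
lemma romanFactorialReal_add_one {a : ℝ} (ha : a ≠ -1) :
    romanFactorialReal (a + 1) = (a + 1) * romanFactorialReal a := by
  by_cases h : IsNegInt a
  · obtain ⟨n, rfl⟩ := h
    obtain ⟨m, rfl⟩ : ∃ m, n = m + 1 :=
      Nat.exists_eq_succ_of_ne_zero fun h => ha (by simp [h])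
    have h1 : -(((m + 1 : ℕ) : ℝ) + 1) + 1 = -((m : ℝ) + 1) := by push_cast; ring
    rw [h1, romanFactorialReal_of_neg, romanFactorialReal_of_neg, Nat.factorial_succ, pow_succ]
    push_cast
    field_simp
  · have h1 : ¬ IsNegInt (a + 1) := fun ⟨n, hn⟩ => h ⟨n + 1, by push_cast; linarith⟩
    rw [romanFactorialReal, romanFactorialReal, if_neg h, if_neg h1,
      Real.Gamma_add_one fun h0 => ha (by linarith)]

section Pairing

variable {E : Type} [CommRing E] [LinearOrder E] [IsStrictOrderedRing E] [Algebra E ℝ]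

lemma romanFactorial_ne_zero (a : E) : romanFactorial a ≠ 0 :=
  Complex.ofReal_ne_zero.2 (romanFactorialReal_ne_zero _)

@[simp] lemma romanFactorial_zero : romanFactorial (0 : E) = 1 := by
  have h : ¬ IsNegInt (0 : ℝ) := fun ⟨n, hn⟩ => by linarith [(Nat.cast_nonneg n : (0 : ℝ) ≤ n)]
  simp [romanFactorial, romanFactorialReal, h]

lemma romanFactorial_add_one [FaithfulSMul E ℝ] {a : E} (ha : a ≠ -1) :
    romanFactorial (a + 1) = (expC a + 1) * romanFactorial a := by
  have h : algebraMap E ℝ a ≠ -1 := fun h =>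
    ha (FaithfulSMul.algebraMap_injective E ℝ (by simpa using h))
  simp [romanFactorial, expC, romanFactorialReal_add_one h]

/-! ### The pairing of operators and series -/

@[simp] lemma toArtinian_coeff (p : HahnSeries Eᵒᵈ ℂ) (c : E) :
    (toArtinian p).coeff c = romanFactorial (-c) * p.coeff (OrderDual.toDual (-c)) := rfl

@[simp] lemma ofArtinian_coeff (q : ArtinianOp E) (b : Eᵒᵈ) :
    (ofArtinian q).coeff b =
      q.coeff (-(OrderDual.ofDual b)) / romanFactorial (OrderDual.ofDual b) := rfl

@[simp] lemma toArtinian_ofArtinian (q : ArtinianOp E) : toArtinian (ofArtinian q) = q := by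
  ext c
  simp [mul_div_cancel₀, romanFactorial_ne_zero]

@[simp] lemma ofArtinian_toArtinian (p : HahnSeries Eᵒᵈ ℂ) : ofArtinian (toArtinian p) = p := by
  ext c
  simp [romanFactorial_ne_zero]

lemma toArtinian_injective :
    Function.Injective (toArtinian : HahnSeries Eᵒᵈ ℂ → ArtinianOp E) :=
  Function.LeftInverse.injective ofArtinian_toArtinian

/-- The bijection `toArtinian` as a linear map. -/
def toArtinianLin : HahnSeries Eᵒᵈ ℂ →ₗ[ℂ] ArtinianOp E where
  toFun := toArtinian
  map_add' p q := by ext c; simp [mul_add]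
  map_smul' r p := by ext c; simp [mul_left_comm]

@[simp] lemma toArtinianLin_apply (p : HahnSeries Eᵒᵈ ℂ) : toArtinianLin p = toArtinian p := rfl

@[simp] lemma toArtinian_single (a : E) (c : ℂ) :
    toArtinian (HahnSeries.single (OrderDual.toDual a) c) =
      HahnSeries.single (-a) (romanFactorial a * c) := by
  ext b
  by_cases h : b = -a
  · subst h; simp
  · have : OrderDual.toDual (-b) ≠ OrderDual.toDual a := fun h' =>
      h (by rw [← OrderDual.toDual.injective h', neg_neg])
    rw [toArtinian_coeff, HahnSeries.coeff_single_of_ne this, mul_zero,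
      HahnSeries.coeff_single_of_ne h]

lemma aug_actLog (f : ArtinianOp E) {α : LogIndex} (hα : α ≠ 0) (p : LogSpace E α) :
    aug (actLog f hα p) = (f * toArtinian p.1).coeff 0 := by
  simp [aug, lcoeff, actLog, act]

lemma mul_coeff_eq_zero {f g : ArtinianOp E} {S : Set E} (hS : S.IsPWO) (hg : g.support ⊆ S)
    {a : E} (h : ∀ ij ∈ Finset.antidiagonal f.isPWO_support hS a, g.coeff ij.2 = 0) :
    (f * g).coeff a = 0 := by
  rw [HahnSeries.coeff_mul_right' hS hg]
  exact Finset.sum_eq_zero fun ij hij => by rw [h ij hij, mul_zero]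

/-- The functional `⟨f(D) ·⟩`. -/
def pairing (f : ArtinianOp E) : HahnSeries Eᵒᵈ ℂ →ₗ[ℂ] ℂ where
  toFun p := (f * toArtinian p).coeff 0
  map_add' p q := by
    rw [← toArtinianLin_apply, map_add, mul_add, HahnSeries.coeff_add]; rfl
  map_smul' r p := by
    rw [← toArtinianLin_apply, map_smul, mul_smul_hahn, HahnSeries.coeff_smul]; rfl

lemma pairing_apply (f : ArtinianOp E) (p : HahnSeries Eᵒᵈ ℂ) :
    pairing f p = (f * toArtinian p).coeff 0 := rfl

/-- Two well-ordered supports contain only finitely many pairs of exponents with sum `0`. -/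
lemma isFinitary_pairing (f : ArtinianOp E) : IsFinitary (pairing f) := by
  classical
  intro S hS
  have hS' : ((fun a : Eᵒᵈ => -(OrderDual.ofDual a)) '' S).IsPWO :=
    hS.image_of_monotone fun a b h => neg_le_neg h
  refine ⟨(Finset.antidiagonal f.isPWO_support hS' 0).image fun ij => OrderDual.toDual (-ij.2),
    fun p hp h => ?_⟩
  refine mul_coeff_eq_zero hS' (fun c hc => ?_) fun ij hij => ?_
  · exact ⟨OrderDual.toDual (-c), hp (right_ne_zero_of_mul hc), by simp⟩
  · rw [toArtinian_coeff, h _ (Finset.mem_image_of_mem _ hij), mul_zero]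

lemma pairing_single (f : ArtinianOp E) (a : E) :
    pairing f (HahnSeries.single (OrderDual.toDual a) 1) = f.coeff a * romanFactorial a := by
  rw [pairing_apply, toArtinian_single, mul_one, HahnSeries.coeff_mul_single]
  simp

/-- Every continuous functional on `I^α`, `α ≠ (0)`, is `⟨g(D) ·⟩` for an Artinian operator. -/
lemma IsFinitary.exists_eq_pairing {l : HahnSeries Eᵒᵈ ℂ →ₗ[ℂ] ℂ} (hl : IsFinitary l) :
    ∃ g : ArtinianOp E, l = pairing g := by
  have hpwo : (Function.support fun a : E =>
      l (HahnSeries.single (OrderDual.toDual a) 1) / romanFactorial a).IsPWO := by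
    refine isPWO_of_no_strictAnti fun f hf h => ?_
    have hmono : StrictMono fun n => OrderDual.toDual (f n) := fun m n hmn => hf hmn
    -- A descending sequence of exponents is an admissible support in the dual order. So `l` depends
    -- on finitely many of its monomials and vanishes on the others, contrary to the choice of the
    -- sequence.
    obtain ⟨A, hA⟩ := hl (Set.range fun n => OrderDual.toDual (f n))
      (isPWO_range_of_monotone hmono.monotone)
    obtain ⟨_, ⟨n, rfl⟩, hn⟩ := (Set.infinite_range_of_injective hmono.injective).exists_notMem_finset A
    refine h n ?_
    simp only
    rw [hA _ (fun a ha => ⟨n, (HahnSeries.eq_of_mem_support_single ha).symm⟩), zero_div]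
    intro s hs
    exact HahnSeries.coeff_single_of_ne fun h => hn (h ▸ hs)
  refine ⟨⟨_, hpwo⟩, sub_eq_zero.1 ((hl.sub (isFinitary_pairing _)).eq_zero fun a => ?_)⟩
  rw [LinearMap.sub_apply, sub_eq_zero, ← OrderDual.toDual_ofDual a, pairing_single]
  simp [romanFactorial_ne_zero]

lemma eq_of_pairing_eq {f g : ArtinianOp E} (h : pairing f = pairing g) : f = g := by
  ext a
  have h1 := DFunLike.congr_fun h (HahnSeries.single (OrderDual.toDual a) 1)
  rw [pairing_single, pairing_single] at h1
  exact mul_right_cancel₀ (romanFactorial_ne_zero a) h1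

lemma eq_of_forall_pairing_eq {p q : HahnSeries Eᵒᵈ ℂ}
    (h : ∀ f : ArtinianOp E, pairing f p = pairing f q) : p = q := by
  refine toArtinian_injective (HahnSeries.ext (funext fun a => ?_))
  have h1 := h (HahnSeries.single (-a) 1)
  simpa [pairing_apply, HahnSeries.coeff_single_mul] using h1

/-- The adjoint of a continuous operator exists. -/
lemma exists_adjoint {T : HahnSeries Eᵒᵈ ℂ →ₗ[ℂ] HahnSeries Eᵒᵈ ℂ}
    (hT : Continuous[seriesTopology Eᵒᵈ, seriesTopology Eᵒᵈ] T) :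
    ∃ Q : ArtinianOp E →ₗ[ℂ] ArtinianOp E, ∀ f p, pairing (Q f) p = pairing f (T p) := by
  choose Q hQ using fun f : ArtinianOp E => ((isFinitary_pairing f).comp hT).exists_eq_pairing
  have hQ' : ∀ f p, pairing (Q f) p = pairing f (T p) := fun f p => by rw [← hQ]; rfl
  refine ⟨⟨⟨Q, fun f g => ?_⟩, fun c f => ?_⟩, hQ'⟩
  · refine eq_of_pairing_eq (LinearMap.ext fun p => ?_)
    rw [hQ', pairing_apply, pairing_apply, add_mul, add_mul, HahnSeries.coeff_add,
      HahnSeries.coeff_add]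
    simp only [← pairing_apply, hQ']
  · refine eq_of_pairing_eq (LinearMap.ext fun p => ?_)
    rw [hQ', RingHom.id_apply, pairing_apply, pairing_apply, smul_mul_hahn, smul_mul_hahn,
      HahnSeries.coeff_smul, HahnSeries.coeff_smul]
    simp only [← pairing_apply, hQ']

lemma continuous_mul_euler (h : ArtinianOp E) {Q : ArtinianOp E →ₗ[ℂ] ArtinianOp E}
    (hQ : ∀ f, Q f = h * euler f) : Continuous[seriesTopology E, seriesTopology E] Q := by
  classical
  let l (a : E) : ArtinianOp E →ₗ[ℂ] ℂ :=
    { toFun := fun f => (Q f).coeff a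
      map_add' := fun f g => by rw [map_add, HahnSeries.coeff_add]
      map_smul' := fun c f => by rw [map_smul, HahnSeries.coeff_smul]; rfl }
  refine continuous_of_isFinitary (fun S hS => ?_) l (fun a S hS => ?_) fun a p => rfl
  · refine ⟨h.support + S, h.isPWO_support.add hS, fun p hp => ?_⟩
    rw [hQ]
    exact HahnSeries.support_mul_subset.trans (Set.add_subset_add_left ((support_euler p).trans hp))
  · refine ⟨(Finset.antidiagonal h.isPWO_support hS a).image Prod.snd, fun p hp hA => ?_⟩
    change (Q p).coeff a = 0
    rw [hQ]
    refine mul_coeff_eq_zero hS ((support_euler p).trans hp) fun ij hij => ?_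
    rw [euler_coeff, hA _ (Finset.mem_image_of_mem _ hij), mul_zero]

end Pairing

section Transfer

variable {E : Type} [CommRing E] [LinearOrder E] [IsStrictOrderedRing E] [Algebra E ℝ]

/-! ### Orders and leading coefficients -/

lemma order_eq_of_coeff {f : ArtinianOp E} {a : E} (h : f.coeff a ≠ 0)
    (h' : ∀ b < a, f.coeff b = 0) : f.order = a := by
  refine le_antisymm (HahnSeries.order_le_of_coeff_ne_zero h) (le_of_not_gt fun hlt => ?_)
  exact HahnSeries.leadingCoeff_ne_zero.2 (HahnSeries.ne_zero_of_coeff_ne_zero h)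
    (HahnSeries.leadingCoeff_eq.trans (h' _ hlt))

lemma IsDelta.ne_zero {f : ArtinianOp E} (hf : IsDelta f) : f ≠ 0 :=
  HahnSeries.ne_zero_of_coeff_ne_zero hf.1

lemma IsDelta.order_eq {f : ArtinianOp E} (hf : IsDelta f) : f.order = 1 :=
  order_eq_of_coeff hf.1 hf.2

lemma IsDelta.euler {f : ArtinianOp E} (hf : IsDelta f) : IsDelta (euler f) :=
  ⟨by simpa using hf.1, fun a ha => by simp [hf.2 a ha]⟩

lemma binPow_order {u : ArtinianOp E} (hu : 0 < u.orderTop) (a : E) : (binPow u a).order = 0 :=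
  order_eq_of_coeff (by simp [binPow_coeff_zero]) fun _ hb => by_contra fun h =>
    (powSupport_nonneg hu (support_binPow_subset hu a h)).not_gt hb

lemma artPow_order {f : ArtinianOp E} (hf : f ≠ 0) (a : E) (n : ℤ) :
    (artPow f a n).order = a * f.order := by
  rw [artPow_eq, HahnSeries.order_mul (HahnSeries.single_ne_zero (powScalar_ne_zero f a n))
    (binPow_ne_zero _ _), HahnSeries.order_single (powScalar_ne_zero f a n),
    binPow_order (tail_orderTop_pos hf), add_zero]

lemma artPow_leadingCoeff {f : ArtinianOp E} (hf : f ≠ 0) (a : E) (n : ℤ) :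
    (artPow f a n).leadingCoeff = powScalar f a n := by
  rw [artPow_eq, HahnSeries.leadingCoeff_mul, HahnSeries.leadingCoeff_of_single,
    HahnSeries.leadingCoeff_eq, binPow_order (tail_orderTop_pos hf), binPow_coeff_zero, mul_one]

lemma artPow_natCast {f : ArtinianOp E} (hf : f ≠ 0) (k : ℕ) (n : ℤ) :
    artPow f (k : E) n = f ^ k := by
  induction k with
  | zero => simp
  | succ k ih => rw [Nat.cast_succ, artPow_add, ih, artPow_one hf, pow_succ]

lemma support_artPow_subset {f : ArtinianOp E} (hf : f ≠ 0) (a : E) (n : ℤ) :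
    (artPow f a n).support ⊆ {a * f.order} + powSupport (tail f) := by
  rw [artPow_eq]
  exact HahnSeries.support_mul_subset.trans
    (Set.add_subset_add HahnSeries.support_single_subset
      (support_binPow_subset (tail_orderTop_pos hf) a))

/-! ### The basis dual to the powers of a delta operator -/

/-- The operator `f^{-a-1} (Df')` dual to `f^a`; it is `p_a / ⌊a⌉!` for the Roman graded sequence
`p_a` associated with `f`. -/
def dualPow (f : ArtinianOp E) (a : E) : ArtinianOp E := artPow f (-a - 1) 0 * euler f

lemma artPow_mul_dualPow (f : ArtinianOp E) (a b : E) :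
    artPow f b 0 * dualPow f a = dualPow f (a - b) := by
  rw [dualPow, dualPow, ← mul_assoc, ← artPow_add]
  congr 2
  ring

lemma dualPow_ne_zero {f : ArtinianOp E} (hf : IsDelta f) (a : E) : dualPow f a ≠ 0 :=
  mul_ne_zero (artPow_ne_zero _ _ _) hf.euler.ne_zero

lemma dualPow_order {f : ArtinianOp E} (hf : IsDelta f) (a : E) : (dualPow f a).order = -a := by
  rw [dualPow, HahnSeries.order_mul (artPow_ne_zero _ _ _) hf.euler.ne_zero,
    artPow_order hf.ne_zero, hf.order_eq, hf.euler.order_eq]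
  ring

lemma dualPow_coeff_neg_ne_zero {f : ArtinianOp E} (hf : IsDelta f) (a : E) :
    (dualPow f a).coeff (-a) ≠ 0 := by
  rw [← dualPow_order hf, ← HahnSeries.leadingCoeff_eq]
  exact HahnSeries.leadingCoeff_ne_zero.2 (dualPow_ne_zero hf a)

/-- For `a ≠ 0` the operator is `-1/a` times the Euler derivative of `f^{-a}`, hence has no residue.
For `a = 0` it is the logarithmic derivative of `f`, whose constant term is the degree of `f`. Since
multiplying by `f^b` shifts the index, this is biorthogonality to the powers of `f`. -/
lemma dualPow_coeff_zero [FaithfulSMul E ℝ] {f : ArtinianOp E} (hf : IsDelta f) (a : E) :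
    (dualPow f a).coeff 0 = if a = 0 then 1 else 0 := by
  split_ifs with h
  · subst h
    have h2 : f.coeff 1 = powScalar f 1 0 := by
      rw [powScalar_one hf.ne_zero, HahnSeries.leadingCoeff_eq, hf.order_eq]
    have h1 := HahnSeries.coeff_mul_order_add_order (artPow f (-0 - 1) 0) (euler f)
    rwa [artPow_order hf.ne_zero, artPow_leadingCoeff hf.ne_zero, HahnSeries.leadingCoeff_eq,
      hf.euler.order_eq, hf.order_eq, euler_coeff, expC_one, one_mul, h2, ← powScalar_add,
      show (-0 - 1 : E) + 1 = 0 by ring, show (-0 - 1 : E) * 1 + 1 = 0 by ring,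
      powScalar_zero] at h1
  · have h1 : expC (-a) ≠ 0 := fun h' => h (neg_eq_zero.1 (expC_eq_zero.1 h'))
    have h2 := euler_coeff_zero (artPow f (-a) 0)
    rw [euler_artPow hf.ne_zero, HahnSeries.coeff_smul, smul_eq_mul] at h2
    rw [dualPow, mul_comm]
    exact (mul_eq_zero.1 h2).resolve_left h1

/-- The lowest term of `g - h` would pair nontrivially with the dual power of opposite order. -/
lemma eq_of_forall_mul_dualPow {f g h : ArtinianOp E} (hf : IsDelta f)
    (H : ∀ a, (g * dualPow f a).coeff 0 = (h * dualPow f a).coeff 0) : g = h := by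
  by_contra hne
  have hd : g - h ≠ 0 := sub_ne_zero.2 hne
  have h1 := HahnSeries.coeff_mul_order_add_order (g - h) (dualPow f (g - h).order)
  rw [dualPow_order hf, add_neg_cancel, sub_mul, HahnSeries.coeff_sub, H, sub_self] at h1
  exact mul_ne_zero (HahnSeries.leadingCoeff_ne_zero.2 hd)
    (HahnSeries.leadingCoeff_ne_zero.2 (dualPow_ne_zero hf _)) h1.symm

/-- The operator `D⁻¹ (Df')`, of degree zero for a delta operator `f`. -/
def deriv (f : ArtinianOp E) : ArtinianOp E := HahnSeries.single (-1) 1 * euler f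

lemma dualPow_eq {f : ArtinianOp E} (hf : IsDelta f) (a : E) :
    dualPow f a = HahnSeries.single (-a) (powScalar f (-a - 1) 0) *
      (binPow (tail f) (-a - 1) * deriv f) := by
  have h : HahnSeries.single ((-a - 1) * f.order) (powScalar f (-a - 1) 0) =
      HahnSeries.single (-a) (powScalar f (-a - 1) 0) * HahnSeries.single (-1) 1 := by
    rw [HahnSeries.single_mul_single, hf.order_eq, mul_one, mul_one, sub_eq_add_neg]
  rw [dualPow, artPow_eq, h, deriv]
  ring

/-- A well-ordered set containing the supports of all `D^a dualPow f a`. -/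
def dualSupport (f : ArtinianOp E) : Set E := powSupport (tail f) + (deriv f).support

lemma dualSupport_isPWO {f : ArtinianOp E} (hf : f ≠ 0) : (dualSupport f).IsPWO :=
  (powSupport_isPWO (tail_orderTop_pos hf)).add (deriv f).isPWO_support

lemma support_dualPow_subset {f : ArtinianOp E} (hf : IsDelta f) (a : E) :
    (dualPow f a).support ⊆ {-a} + dualSupport f := by
  rw [dualPow_eq hf]
  exact HahnSeries.support_mul_subset.trans (Set.add_subset_add HahnSeries.support_single_subset
    (HahnSeries.support_mul_subset.trans (Set.add_subset_add_right
      (support_binPow_subset (tail_orderTop_pos hf.ne_zero) _))))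

lemma mem_of_mul_dualPow_coeff_ne_zero {f : ArtinianOp E} (hf : IsDelta f) (g : ArtinianOp E)
    {a : E} (ha : (g * dualPow f a).coeff 0 ≠ 0) : a ∈ g.support + dualSupport f := by
  obtain ⟨x, hx, y, hy, hxy⟩ := Set.mem_add.1
    (HahnSeries.support_mul_subset ((HahnSeries.mem_support _ _).2 ha))
  obtain ⟨w, hw, z, hz, rfl⟩ := Set.mem_add.1 (support_dualPow_subset hf a hy)
  rw [Set.mem_singleton_iff] at hw
  subst hw
  exact Set.mem_add.2 ⟨x, hx, z, hz, by linear_combination hxy⟩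

/-! ### Expansion in powers of a delta operator -/

/-- The series of the coordinates `⟨g(D) p_a⟩ / ⌊a⌉!` of `g` with respect to the powers of `f`. -/
def coords {f : ArtinianOp E} (hf : IsDelta f) (g : ArtinianOp E) : ArtinianOp E where
  coeff a := (g * dualPow f a).coeff 0
  isPWO_support' := (g.isPWO_support.add (dualSupport_isPWO hf.ne_zero)).mono
    fun _ ha => mem_of_mul_dualPow_coeff_ne_zero hf g ha

lemma coords_coeff {f : ArtinianOp E} (hf : IsDelta f) (g : ArtinianOp E) (a : E) :
    (coords hf g).coeff a = (g * dualPow f a).coeff 0 := rfl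

/-- The expansion of `g` in powers of `f`. -/
def expansion {f : ArtinianOp E} (hf : IsDelta f) (g : ArtinianOp E) :
    HahnSeries.SummableFamily E ℂ E where
  toFun b := (coords hf g).coeff b • artPow f b 0
  isPWO_iUnion_support' := by
    refine ((coords hf g).isPWO_support.add
      (powSupport_isPWO (tail_orderTop_pos hf.ne_zero))).mono ?_
    refine Set.iUnion_subset fun b x hx => ?_
    rw [HahnSeries.mem_support, HahnSeries.coeff_smul, smul_eq_mul] at hx
    obtain ⟨w, hw, y, hy, rfl⟩ := Set.mem_add.1
      (support_artPow_subset hf.ne_zero b 0 (right_ne_zero_of_mul hx))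
    rw [Set.mem_singleton_iff, hf.order_eq, mul_one] at hw
    subst hw
    exact Set.mem_add.2 ⟨w, left_ne_zero_of_mul hx, y, hy, rfl⟩
  finite_co_support' x := by
    refine ((Finset.antidiagonal (coords hf g).isPWO_support
      (powSupport_isPWO (tail_orderTop_pos hf.ne_zero)) x).image Prod.fst).finite_toSet.subset ?_
    intro b hx
    rw [Set.mem_ofPred_eq, HahnSeries.coeff_smul, smul_eq_mul] at hx
    obtain ⟨w, hw, y, hy, hxy⟩ := Set.mem_add.1
      (support_artPow_subset hf.ne_zero b 0 (right_ne_zero_of_mul hx))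
    rw [Set.mem_singleton_iff, hf.order_eq, mul_one] at hw
    subst hw
    exact Finset.mem_coe.2 (Finset.mem_image.2
      ⟨(w, y), Finset.mem_antidiagonal.2 ⟨left_ne_zero_of_mul hx, hy, hxy⟩, rfl⟩)

lemma mul_dualPow_expansion_coeff {f : ArtinianOp E} (hf : IsDelta f) (g h : ArtinianOp E)
    (a b : E) : (h * dualPow f a * expansion hf g b).coeff 0 =
      (g * dualPow f b).coeff 0 * (h * dualPow f (a - b)).coeff 0 := by
  change (h * dualPow f a * ((coords hf g).coeff b • artPow f b 0)).coeff 0 = _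
  rw [mul_smul_hahn, HahnSeries.coeff_smul, mul_assoc, mul_comm (dualPow f a),
    artPow_mul_dualPow, smul_eq_mul, coords_coeff]

/-- By biorthogonality both sides have the same coordinates, and coordinates separate operators. -/
lemma hsum_expansion [FaithfulSMul E ℝ] {f : ArtinianOp E} (hf : IsDelta f) (g : ArtinianOp E) :
    (expansion hf g).hsum = g := by
  refine eq_of_forall_mul_dualPow hf fun a => ?_
  rw [mul_comm, ← one_mul (dualPow f a), mul_hsum_coeff, finsum_eq_single _ a]
  · rw [mul_dualPow_expansion_coeff, one_mul, one_mul, dualPow_coeff_zero hf, if_pos (sub_self a),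
      mul_one]
  · intro b hb
    rw [mul_dualPow_expansion_coeff, one_mul, dualPow_coeff_zero hf,
      if_neg (sub_ne_zero.2 hb.symm), mul_zero]

lemma finite_support_dualPow {f : ArtinianOp E} (hf : IsDelta f) (g h : ArtinianOp E) (a : E) :
    (Function.support fun b => (g * dualPow f b).coeff 0 *
      (h * dualPow f (a - b)).coeff 0).Finite := by
  simp_rw [← mul_dualPow_expansion_coeff hf]
  exact finite_support_mul_coeff _ _ _

/-- The Roman identity without factorials: expand `g` in powers `f^b`, each of which lowers the
index of the dual power by `b`. -/
lemma mul_mul_dualPow_coeff [FaithfulSMul E ℝ] {f : ArtinianOp E} (hf : IsDelta f)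
    (g h : ArtinianOp E) (a : E) : (g * h * dualPow f a).coeff 0 =
      ∑ᶠ b, (g * dualPow f b).coeff 0 * (h * dualPow f (a - b)).coeff 0 := by
  simp_rw [← mul_dualPow_expansion_coeff hf]
  rw [← mul_hsum_coeff, hsum_expansion, mul_assoc, mul_comm]

/-! ### Continuity in the exponent -/

lemma continuous_ring_choose (k : ℕ) : Continuous fun z : ℂ => Ring.choose z k := by
  induction k with
  | zero => simpa using continuous_const
  | succ k ih =>
    have h : (fun z : ℂ => Ring.choose z (k + 1)) =
        fun z => z * Ring.choose (z - 1) k / ((k : ℂ) + 1) := by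
      funext z
      rw [← ring_choose_succ_mul, mul_div_cancel_left₀]
      exact_mod_cast k.succ_ne_zero
    rw [h]
    fun_prop (disch := assumption)

lemma continuous_binPow_coeff [TopologicalSpace E]
    {u : ArtinianOp E} (hu : 0 < u.orderTop) (t : E) {φ : E → E}
    (hφ : Continuous fun a => expC (φ a)) :
    Continuous fun a => (binPow u (φ a)).coeff t := by
  simp_rw [binPow_coeff_eq_sum hu]
  exact continuous_finsetSum _ fun k _ =>
    ((continuous_ring_choose k).comp hφ).mul continuous_const

/-- After removal of `D^{-a}`, the coefficient is an exponential in `a` times a sum over a finite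
index set independent of `a`, with terms polynomial in `a`. -/
lemma continuous_dualPow_coeff [TopologicalSpace E] (hE : Continuous (expC : E → ℂ))
    {f : ArtinianOp E} (hf : IsDelta f) (s : E) :
    Continuous fun a => (dualPow f a).coeff (s - a) := by
  have hu := tail_orderTop_pos hf.ne_zero
  have h1 : Continuous fun a : E => expC (-a - 1) := by
    simp only [expC_sub, expC_neg]
    fun_prop
  have h2 : ∀ a, (dualPow f a).coeff (s - a) = powScalar f (-a - 1) 0 *
      ∑ ij ∈ Finset.antidiagonal (powSupport_isPWO hu) (deriv f).isPWO_support s,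
        (binPow (tail f) (-a - 1)).coeff ij.1 * (deriv f).coeff ij.2 := fun a => by
    rw [dualPow_eq hf, HahnSeries.coeff_single_mul, sub_neg_eq_add, sub_add_cancel,
      HahnSeries.coeff_mul_left' (powSupport_isPWO hu) (support_binPow_subset hu _)]
  simp_rw [h2]
  refine Continuous.mul ?_ (continuous_finsetSum _ fun ij _ =>
    (continuous_binPow_coeff hu _ h1).mul continuous_const)
  simp only [powScalar]
  fun_prop

end Transfer

section Regular

variable {E : Type} [CommRing E] [LinearOrder E] [IsStrictOrderedRing E] [Algebra E ℝ]
  {J : Set LogIndex}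

/-! ### Regular operators -/

lemma relabel_coe {α : LogIndex} (hα : α ≠ 0) (p : HahnSeries Eᵒᵈ ℂ) : (relabel α p).1 = p := by
  ext a
  exact if_neg fun h => hα h.1

lemma relabel_self {α : LogIndex} (p : LogSpace E α) : relabel α p.1 = p := by
  ext a
  by_cases h : α = 0 ∧ IsNegInt (OrderDual.ofDual a)
  · exact (if_pos h).trans (p.2 h.1 _ h.2).symm
  · exact if_neg h

lemma lcoeff_relabel {α : LogIndex} (p : HahnSeries Eᵒᵈ ℂ) {a : E} (h : ¬ (α = 0 ∧ IsNegInt a)) :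
    lcoeff (relabel α p) a = p.coeff (OrderDual.toDual a) := if_neg h

lemma lcoeff_relabel_zero (p : HahnSeries Eᵒᵈ ℂ) {a : E} (h : IsNegInt a) :
    lcoeff (relabel 0 p) a = 0 := if_pos ⟨rfl, h⟩

lemma lcoeff_relabel_eq_zero {α : LogIndex} {p : HahnSeries Eᵒᵈ ℂ} {a : E}
    (h : p.coeff (OrderDual.toDual a) = 0) : lcoeff (relabel α p) a = 0 := by
  by_cases h' : α = 0 ∧ IsNegInt a
  · exact if_pos h'
  · exact (if_neg h').trans h

lemma skip_lof (α β : J) (p : LogSpace E β.1) :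
    skip α β (DirectSum.lof ℂ J (fun α => LogSpace E α.1) β p) =
      DirectSum.lof ℂ J (fun α => LogSpace E α.1) α (relabel α.1 p.1) := by
  simp only [skip, LinearMap.comp_apply, DirectSum.component.lof_self, Submodule.subtype_apply]

lemma skip_apply (α β : J) (x : LogSum E J) :
    skip α β x = DirectSum.lof ℂ J (fun α => LogSpace E α.1) α
      (relabel α.1 (DirectSum.component ℂ J (fun α => LogSpace E α.1) β x).1) := rfl

/-- The operator on series in the `λ_a` underlying a regular operator. -/
def baseOp (θ : LogSum E J →ₗ[ℂ] LogSum E J) (β : J) : HahnSeries Eᵒᵈ ℂ →ₗ[ℂ] HahnSeries Eᵒᵈ ℂ :=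
  (LogSpace E β.1).subtype ∘ₗ component θ β β ∘ₗ relabel β.1

variable {θ : LogSum E J →ₗ[ℂ] LogSum E J} {β : J}

/-- Commutation with the skip operator from `β` to `α`. The case `α = (0)` is included: there the
negative integer exponents are dropped on both sides. -/
lemma IsRegularOperator.apply_lof_relabel (hθ : IsRegularOperator θ) (hβ : β.1 ≠ 0) (α : J)
    (p : HahnSeries Eᵒᵈ ℂ) :
    θ (DirectSum.lof ℂ J (fun α => LogSpace E α.1) α (relabel α.1 p)) =
      DirectSum.lof ℂ J (fun α => LogSpace E α.1) α (relabel α.1 (baseOp θ β p)) := by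
  have h := LinearMap.congr_fun (hθ α β (Or.inl hβ))
    (DirectSum.lof ℂ J (fun α => LogSpace E α.1) β (relabel β.1 p))
  rw [LinearMap.comp_apply, LinearMap.comp_apply, skip_lof, relabel_coe hβ, skip_apply] at h
  exact h

lemma IsRegularOperator.component_apply (hθ : IsRegularOperator θ) (hβ : β.1 ≠ 0) (α : J)
    (p : LogSpace E α.1) : component θ α α p = relabel α.1 (baseOp θ β p.1) := by
  have h := hθ.apply_lof_relabel hβ α p.1
  rw [relabel_self] at h
  rw [component, LinearMap.comp_apply, LinearMap.comp_apply, h, DirectSum.component.lof_self]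

lemma IsRegularOperator.isAdjoint_iff (hθ : IsRegularOperator θ) (hβ : β.1 ≠ 0)
    (Q : ArtinianOp E →ₗ[ℂ] ArtinianOp E) :
    IsAdjoint θ Q ↔ ∀ f p, pairing (Q f) p = pairing f (baseOp θ β p) := by
  constructor
  · intro h f p
    have h1 := h β hβ f (relabel β.1 p)
    rw [aug_actLog, aug_actLog, hθ.component_apply hβ, relabel_coe hβ, relabel_coe hβ] at h1
    exact h1
  · intro h α hα f p
    rw [aug_actLog, aug_actLog, hθ.component_apply hβ, relabel_coe hα]
    exact h f p.1

lemma IsContinuousOperator.continuous_baseOp (hθ : IsContinuousOperator θ) (hβ : β.1 ≠ 0) :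
    Continuous[seriesTopology Eᵒᵈ, seriesTopology Eᵒᵈ] (baseOp θ β) := by
  have h1 : Continuous[seriesTopology Eᵒᵈ,
      TopologicalSpace.induced Subtype.val (seriesTopology Eᵒᵈ)] (relabel (E := E) β.1) := by
    rw [continuous_induced_rng, show Subtype.val ∘ relabel (E := E) β.1 = id from
      funext fun p => relabel_coe hβ p]
    exact @continuous_id _ (seriesTopology Eᵒᵈ)
  let t : TopologicalSpace (HahnSeries Eᵒᵈ ℂ) := seriesTopology Eᵒᵈ
  let t' : TopologicalSpace (LogSpace E β.1) := TopologicalSpace.induced Subtype.val t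
  exact (continuous_induced_dom (f := Subtype.val) (t := t)).comp ((hθ β β).comp h1)

/-! ### Differential operators -/

lemma mem_differentialOps_iff {f : ArtinianOp E} :
    f ∈ differentialOps E ↔ ∀ c, f.coeff c ≠ 0 → ∃ n : ℕ, c = n := by
  constructor
  · rintro ⟨p, rfl⟩ c hc
    by_contra h
    refine hc ?_
    rw [HahnSeries.ofPowerSeries_apply, HahnSeries.embDomain_notin_image_support]
    rintro ⟨n, -, rfl⟩
    exact h ⟨n, rfl⟩
  · intro h
    refine ⟨PowerSeries.mk fun n => f.coeff n, ?_⟩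
    ext c
    by_cases hc : ∃ n : ℕ, c = n
    · obtain ⟨n, rfl⟩ := hc
      rw [HahnSeries.ofPowerSeries_apply_coeff, PowerSeries.coeff_mk]
    · rw [not_not.1 (mt (h c) hc), HahnSeries.ofPowerSeries_apply,
        HahnSeries.embDomain_notin_image_support]
      rintro ⟨n, -, rfl⟩
      exact hc ⟨n, rfl⟩

lemma single_one_mem_differentialOps :
    (HahnSeries.single 1 1 : ArtinianOp E) ∈ differentialOps E :=
  ⟨PowerSeries.X, HahnSeries.ofPowerSeries_X⟩

lemma euler_mem_differentialOps {f : ArtinianOp E} (hf : f ∈ differentialOps E) :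
    euler f ∈ differentialOps E :=
  mem_differentialOps_iff.2 fun c hc => mem_differentialOps_iff.1 hf c (right_ne_zero_of_mul hc)

/-- For `a = -(n+1)` the dual power is `f^n * euler f`, a differential operator of order `n + 1`.
Hence `p_a` involves only those `λ_b` that vanish in `I^(0)`, as a graded sequence requires. -/
lemma isNegInt_of_dualPow_coeff_ne_zero {f : ArtinianOp E} (hf : IsDelta f) (hf' : f ∈ differentialOps E)
    {a : E} (ha : IsNegInt a) {c : E} (hc : (dualPow f a).coeff c ≠ 0) : IsNegInt (-c) := by
  obtain ⟨n, rfl⟩ := ha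
  have h1 : dualPow f (-((n : E) + 1)) = f ^ n * euler f := by
    rw [dualPow, ← artPow_natCast hf.ne_zero n 0]
    congr 2
    ring
  have h2 : dualPow f (-((n : E) + 1)) ∈ differentialOps E := by
    rw [h1]
    exact mul_mem (pow_mem hf' n) (euler_mem_differentialOps hf')
  obtain ⟨m, rfl⟩ := mem_differentialOps_iff.1 h2 c hc
  have h3 := HahnSeries.order_le_of_coeff_ne_zero hc
  rw [dualPow_order hf, neg_neg] at h3
  have h4 : n + 1 ≤ m := by exact_mod_cast h3
  obtain ⟨k, rfl⟩ : ∃ k, m = k + 1 := ⟨m - 1, by omega⟩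
  exact ⟨k, by push_cast; rfl⟩

/-! ### The Roman graded sequence of a delta operator -/

/-- The series `p_a` of the Roman graded sequence associated with a delta operator. -/
def romanSeries (f : ArtinianOp E) (a : E) : HahnSeries Eᵒᵈ ℂ :=
  romanFactorial a • ofArtinian (dualPow f a)

lemma toArtinian_romanSeries (f : ArtinianOp E) (a : E) :
    toArtinian (romanSeries f a) = romanFactorial a • dualPow f a := by
  rw [← toArtinianLin_apply, romanSeries, map_smul, toArtinianLin_apply, toArtinian_ofArtinian]

lemma pairing_romanSeries (f g : ArtinianOp E) (a : E) :
    pairing g (romanSeries f a) = romanFactorial a * (g * dualPow f a).coeff 0 := by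
  rw [pairing_apply, toArtinian_romanSeries, mul_smul_hahn, HahnSeries.coeff_smul, smul_eq_mul]

lemma romanSeries_coeff (f : ArtinianOp E) (a b : E) :
    (romanSeries f a).coeff (OrderDual.toDual b) =
      romanFactorial a * ((dualPow f a).coeff (-b) / romanFactorial b) := rfl

lemma isRomanSequence_romanSeries [FaithfulSMul E ℝ] [TopologicalSpace E]
    (hE : Continuous (expC : E → ℂ)) {f : ArtinianOp E} (hf : IsDelta f)
    (hJ : ∀ α : J, α.1 = 0 → f ∈ differentialOps E) :
    IsRomanSequence (J := J) fun α a => relabel α.1 (romanSeries f a) := by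
  have haug : ∀ (α : J) (hα : α.1 ≠ 0) (g : ArtinianOp E) (a : E),
      aug (actLog g hα (relabel α.1 (romanSeries f a))) =
        romanFactorial a * (g * dualPow f a).coeff 0 := fun α hα g a => by
    rw [aug_actLog, relabel_coe hα, ← pairing_apply, pairing_romanSeries]
  have hterm : ∀ (α : J) (hα : α.1 ≠ 0) (g h : ArtinianOp E) (a b : E),
      romanCoeff a b * aug (actLog g hα (relabel α.1 (romanSeries f b))) *
        aug (actLog h hα (relabel α.1 (romanSeries f (a - b)))) =
      romanFactorial a * ((g * dualPow f b).coeff 0 * (h * dualPow f (a - b)).coeff 0) := by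
    intro α hα g h a b
    rw [haug, haug, romanCoeff]
    have h1 := romanFactorial_ne_zero b
    have h2 := romanFactorial_ne_zero (a - b)
    field_simp
  refine ⟨⟨fun α a hα ha => ?_, fun α a h => ?_, fun α γ a hγ => ?_, fun α hα s => ?_⟩,
    fun α hα g h a => ?_, fun α hα g h a => ?_⟩
  · refine Subtype.ext (HahnSeries.ext (funext fun b => ?_))
    change lcoeff (relabel α.1 (romanSeries f a)) (OrderDual.ofDual b) = 0
    by_cases hb : IsNegInt (OrderDual.ofDual b)
    · rw [hα, lcoeff_relabel_zero _ hb]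
    · refine lcoeff_relabel_eq_zero ?_
      rw [romanSeries_coeff]
      have : (dualPow f a).coeff (-(OrderDual.ofDual b)) = 0 := by
        by_contra h
        have := isNegInt_of_dualPow_coeff_ne_zero hf (hJ α hα) ha h
        rw [neg_neg] at this
        exact hb this
      rw [this, zero_div, mul_zero]
  · refine ⟨?_, fun b hb => lcoeff_relabel_eq_zero ?_⟩
    · rw [lcoeff_relabel _ h, romanSeries_coeff]
      exact mul_ne_zero (romanFactorial_ne_zero _)
        (div_ne_zero (dualPow_coeff_neg_ne_zero hf a) (romanFactorial_ne_zero _))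
    · rw [romanSeries_coeff, HahnSeries.coeff_eq_zero_of_lt_order, zero_div, mul_zero]
      rw [dualPow_order hf]
      exact neg_lt_neg hb
  · rw [relabel_coe hγ]
  · have h1 : ∀ a, lcoeff (relabel α.1 (romanSeries f a)) (a - s) * romanFactorial (a - s) /
        romanFactorial a = (dualPow f a).coeff (s - a) := fun a => by
      rw [lcoeff_relabel _ fun h => hα h.1, romanSeries_coeff, neg_sub]
      have h1 := romanFactorial_ne_zero a
      have h2 := romanFactorial_ne_zero (a - s)
      field_simp
    simp_rw [h1]
    exact continuous_dualPow_coeff hE hf s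
  · simp_rw [hterm]
    exact (finite_support_dualPow hf g h a).subset fun b hb => right_ne_zero_of_mul hb
  · simp_rw [hterm]
    rw [haug, mul_mul_dualPow_coeff hf, mul_finsum]

/-! ### Adjoints that are derivations -/

/-- Adjointness writes each coefficient of `Q f` as the residue of `f` against a fixed operator.
That operator is determined by the monomials, so no continuity of `Q` is needed. -/
lemma adjoint_eq_mul_euler {T : HahnSeries Eᵒᵈ ℂ →ₗ[ℂ] HahnSeries Eᵒᵈ ℂ}
    {Q : ArtinianOp E →ₗ[ℂ] ArtinianOp E} (hQ : ∀ f p, pairing (Q f) p = pairing f (T p))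
    {q : ArtinianOp E}
    (hpow : ∀ a, Q (HahnSeries.single a 1) = expC a • (q * HahnSeries.single a 1))
    (f : ArtinianOp E) : Q f = q * euler f := by
  ext a
  have h1 : ∀ f, (Q f).coeff a =
      (f * toArtinian (T (ofArtinian (HahnSeries.single (-a) 1)))).coeff 0 := fun f => by
    have h := hQ f (ofArtinian (HahnSeries.single (-a) 1))
    rw [pairing_apply, toArtinian_ofArtinian, HahnSeries.coeff_mul_single] at h
    simpa [pairing_apply] using h
  -- Testing against `D^{-c}` reads off the coefficient at `c`; the sign is the one that integration
  -- by parts cancels below.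
  have h2 : toArtinian (T (ofArtinian (HahnSeries.single (-a) 1))) =
      (-1 : ℂ) • euler (q * HahnSeries.single (-a) 1) := by
    ext c
    have h := h1 (HahnSeries.single (-c) 1)
    rw [hpow, HahnSeries.coeff_single_mul, HahnSeries.coeff_smul,
      HahnSeries.coeff_mul_single] at h
    rw [HahnSeries.coeff_smul, euler_coeff, HahnSeries.coeff_mul_single]
    simp only [zero_add, one_mul, mul_one, smul_eq_mul, expC_neg, sub_neg_eq_add] at h ⊢
    rw [← h, add_comm c a]
    ring
  rw [h1, h2, mul_smul_hahn, HahnSeries.coeff_smul, smul_eq_mul, neg_one_mul, ← euler_mul_coeff_zero, ← mul_assoc,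
    HahnSeries.coeff_mul_single, mul_comm q]
  simp

lemma artPow_single_one (a : E) :
    artPow (HahnSeries.single 1 1 : ArtinianOp E) a 0 = HahnSeries.single a 1 := by
  have h : tail (HahnSeries.single 1 1 : ArtinianOp E) = 0 := by
    rw [tail, HahnSeries.order_single one_ne_zero, HahnSeries.leadingCoeff_of_single,
      HahnSeries.single_mul_single]
    simp
  have h0 : 0 < (0 : ArtinianOp E).orderTop := by simp
  have h1 : binPow (0 : ArtinianOp E) a = 1 := by
    ext t
    rw [binPow_coeff h0, finsum_eq_single _ 0 fun k hk => by simp [hk]]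
    simp
  rw [artPow_eq, h, h1, HahnSeries.order_single one_ne_zero, powScalar,
    HahnSeries.leadingCoeff_of_single]
  simp

/-- Every `D^a` is an Artinian power of `D ∈ L`, even when `D^a ∉ L`; the second factor in the
product rule is taken to be `1`. -/
lemma IsContinuousArtinianDerivation.apply_single {L : Subring (ArtinianOp E)}
    {Q : ArtinianOp E →ₗ[ℂ] ArtinianOp E} (hQ : IsContinuousArtinianDerivation L Q)
    (hL : HahnSeries.single 1 1 ∈ L) (a : E) :
    Q (HahnSeries.single a 1) = expC a • (Q (HahnSeries.single 1 1) * HahnSeries.single (-1) 1 *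
      HahnSeries.single a 1) := by
  have h := hQ.2.2 _ hL 1 (one_mem L) (HahnSeries.single_ne_zero one_ne_zero) one_ne_zero a 0 0 0
  rw [artPow_single_one, artPow_single_one, artPow_zero, mul_one, mul_one, expC_zero,
    ← HahnSeries.C_mul_eq_smul (r := (0 : ℂ)), map_zero, zero_mul, add_zero] at h
  rw [h, mul_assoc, HahnSeries.single_mul_single, mul_one, sub_eq_neg_add]

lemma isRomanShift_of_derivation [FaithfulSMul E ℝ] [TopologicalSpace E]
    (hE : Continuous (expC : E → ℂ)) (hθ : IsRegularOperator θ) (hβ : β.1 ≠ 0)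
    {L : Subring (ArtinianOp E)} (hL : HahnSeries.single 1 1 ∈ L)
    (hJ : ∀ α : J, α.1 = 0 → L = differentialOps E)
    {Q : ArtinianOp E →ₗ[ℂ] ArtinianOp E} (hQ : IsAdjoint θ Q)
    (hder : IsContinuousArtinianDerivation L Q) {f : ArtinianOp E} (hf : f ∈ L)
    (hdelta : IsDelta f) (hQf : Q f = 1) : IsRomanShift θ := by
  have hadj := (hθ.isAdjoint_iff hβ Q).1 hQ
  set q := Q (HahnSeries.single 1 1) * HahnSeries.single (-1) 1 with hq
  have hQeq := adjoint_eq_mul_euler hadj (q := q) (hder.apply_single hL)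
  have hqf : q * euler f = 1 := by rw [← hQeq, hQf]
  refine ⟨fun α a => relabel α.1 (romanSeries f a),
    isRomanSequence_romanSeries hE hdelta fun α hα => hJ α hα ▸ hf, fun α a => ?_⟩
  -- Since `q * euler f = 1`, the factor `euler f` of the dual power cancels and leaves `f^{-a-1}`,
  -- to which integration by parts moves the Euler operator. The factor `a + 1` is the step of the
  -- Roman factorial, and it vanishes at `a = -1`.
  have hshift : ∀ g, pairing g (baseOp θ β (romanSeries f a)) =
      romanFactorial a * ((expC a + 1) * (g * dualPow f (a + 1)).coeff 0) := by
    intro g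
    rw [← hadj, pairing_romanSeries, hQeq]
    have h1 : q * euler g * dualPow f a = euler g * artPow f (-a - 1) 0 := by
      rw [dualPow, ← mul_one (euler g * artPow f (-a - 1) 0), ← hqf]
      ring
    have h2 : -a - 1 - 1 = -(a + 1) - 1 := by ring
    rw [h1, euler_mul_coeff_zero, euler_artPow hdelta.ne_zero, mul_smul_hahn,
      HahnSeries.coeff_smul, smul_eq_mul, mul_comm (euler f), h2, ← dualPow, expC_sub, expC_neg,
      expC_one]
    ring
  rw [hθ.apply_lof_relabel hβ]
  split_ifs with ha
  · have h0 : baseOp θ β (romanSeries f a) = 0 := by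
      refine eq_of_forall_pairing_eq fun g => ?_
      rw [hshift, ha]
      simp
    rw [h0, map_zero, map_zero]
  · have h0 : baseOp θ β (romanSeries f a) = romanSeries f (a + 1) := by
      refine eq_of_forall_pairing_eq fun g => ?_
      rw [hshift, pairing_romanSeries, romanFactorial_add_one ha]
      ring
    rw [h0]

end Regular

section Binomial

variable {E : Type} [CommRing E] [LinearOrder E] [IsStrictOrderedRing E] [Algebra E ℝ]

/-! ### Families of binomial type -/

lemma mul_coeff_eq_finsum (f g : ArtinianOp E) (a : E) :
    (f * g).coeff a = ∑ᶠ c, f.coeff c * g.coeff (a - c) := by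
  classical
  rw [finsum_eq_sum_of_support_subset (s := (Finset.antidiagonal f.isPWO_support
    g.isPWO_support a).image Prod.fst), Finset.sum_image, HahnSeries.coeff_mul]
  · refine Finset.sum_congr rfl fun ij hij => ?_
    rw [← (Finset.mem_antidiagonal.1 hij).2.2, add_sub_cancel_left]
  · intro x hx y hy hxy
    have h1 := (Finset.mem_antidiagonal.1 hx).2.2
    have h2 := (Finset.mem_antidiagonal.1 hy).2.2
    refine Prod.ext hxy ?_
    rw [← h2, hxy] at h1
    exact add_left_cancel h1
  · intro c hc
    exact Finset.mem_coe.2 (Finset.mem_image.2 ⟨(c, a - c), Finset.mem_antidiagonal.2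
      ⟨left_ne_zero_of_mul hc, right_ne_zero_of_mul hc, add_sub_cancel _ _⟩, rfl⟩)

/-- A triangular system with nonzero diagonal has a solution with nonzero right-hand sides. -/
lemma exists_forall_sum_ne_zero (K : ℕ → ℕ → ℂ) (hK : ∀ n, K n n ≠ 0) :
    ∃ g : ℕ → ℂ, ∀ n, ∑ k ∈ Finset.range (n + 1), g k * K n k ≠ 0 := by
  classical
  -- Greedy choice: `g n` is `0` if the earlier terms already have nonzero sum, and `1` otherwise,
  -- when the diagonal term alone remains.
  let g : ℕ → ℂ := Nat.strongRec fun n ih =>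
    if ∑ k : Fin n, ih k k.2 * K n k = 0 then 1 else 0
  have hg : ∀ n, g n = if ∑ k ∈ Finset.range n, g k * K n k = 0 then 1 else 0 := by
    intro n
    rw [Finset.sum_range]
    exact Nat.strongRec_eq _ n
  refine ⟨g, fun n => ?_⟩
  rw [Finset.sum_range_succ, hg n]
  split_ifs with h
  · rw [h, zero_add, one_mul]
    exact hK n
  · rwa [zero_mul, add_zero]

/-- A family `M_a` of degree `-a` for which `⟨f, a⟩ := (f M_a)_0` is of binomial type. -/
structure IsBinomialFamily (M : E → ArtinianOp E) : Prop where
  coeff_ne_zero : ∀ a, (M a).coeff (-a) ≠ 0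
  coeff_eq_zero : ∀ a, ∀ c < -a, (M a).coeff c = 0
  finite_support : ∀ (f g : ArtinianOp E) (a : E),
    (Function.support fun b => (f * M b).coeff 0 * (g * M (a - b)).coeff 0).Finite
  binomial : ∀ (f g : ArtinianOp E) (a : E),
    (f * g * M a).coeff 0 = ∑ᶠ b, (f * M b).coeff 0 * (g * M (a - b)).coeff 0

namespace IsBinomialFamily

variable {M : E → ArtinianOp E}

/-- If the coordinates of `f` were nonzero along a descending sequence `b n`, one could build an
operator `G` with nonzero coordinates at every `-b n`. The binomial sum for `f * G` at `a = 0` would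
then have infinitely many nonzero terms. -/
lemma isPWO_support (hM : IsBinomialFamily M) (f : ArtinianOp E) :
    (Function.support fun a => (f * M a).coeff 0).IsPWO := by
  classical
  refine isPWO_of_no_strictAnti fun b hb hbf => ?_
  have he : StrictMono fun n => -b n := fun m n h => neg_lt_neg (hb h)
  obtain ⟨g, hg⟩ := exists_forall_sum_ne_zero (fun n k => (M (-b n)).coeff (- -b k))
    fun n => hM.coeff_ne_zero _
  let G : ArtinianOp E := HahnSeries.embDomain (OrderEmbedding.ofStrictMono _ he)
    (⟨g, Set.isPWO_of_wellQuasiOrderedLE _⟩ : HahnSeries ℕ ℂ)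
  have hG1 : ∀ n, G.coeff (-b n) = g n := fun n =>
    HahnSeries.embDomain_coeff (f := OrderEmbedding.ofStrictMono _ he)
  have hG2 : ∀ c, G.coeff c ≠ 0 → ∃ n, -b n = c := fun c hc => by
    by_contra h
    exact hc (HahnSeries.embDomain_of_notMem_range fun ⟨n, hn⟩ => h ⟨n, hn⟩)
  -- `M (-b n)` starts in degree `b n`, so only the terms of `G` with `k ≤ n` contribute: the system
  -- is triangular.
  have hG3 : ∀ n, (G * M (-b n)).coeff 0 ≠ 0 := by
    intro n
    rw [mul_coeff_eq_finsum, finsum_eq_sum_of_support_subset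
      (s := (Finset.range (n + 1)).image fun k => -b k), Finset.sum_image he.injective.injOn]
    · simp_rw [hG1, zero_sub]
      exact hg n
    · intro c hc
      obtain ⟨k, rfl⟩ := hG2 c (left_ne_zero_of_mul hc)
      refine Finset.mem_coe.2 (Finset.mem_image.2 ⟨k, Finset.mem_range_succ_iff.2 ?_, rfl⟩)
      by_contra hk
      refine right_ne_zero_of_mul hc (hM.coeff_eq_zero _ _ ?_)
      rw [zero_sub]
      exact neg_lt_neg (he (not_le.1 hk))
  refine (Set.infinite_range_of_injective hb.injective)
    ((hM.finite_support f G 0).subset ?_)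
  rintro _ ⟨n, rfl⟩
  rw [Function.mem_support, zero_sub]
  exact mul_ne_zero (hbf n) (hG3 n)

/-- The series `∑_a (f M_a)_0 D^a`. -/
def transform (hM : IsBinomialFamily M) : ArtinianOp E →ₗ[ℂ] ArtinianOp E where
  toFun f := ⟨fun a => (f * M a).coeff 0, hM.isPWO_support f⟩
  map_add' f g := by ext a; simp [add_mul]
  map_smul' c f := by ext a; simp [smul_mul_hahn]

lemma transform_coeff (hM : IsBinomialFamily M) (f : ArtinianOp E) (a : E) :
    (hM.transform f).coeff a = (f * M a).coeff 0 := rfl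

/-- The binomial identity is exactly the convolution formula for coefficients of a product. -/
lemma transform_mul (hM : IsBinomialFamily M) (f g : ArtinianOp E) :
    hM.transform (f * g) = hM.transform f * hM.transform g := by
  ext a
  rw [transform_coeff, hM.binomial, mul_coeff_eq_finsum]
  rfl

lemma order_eq (hM : IsBinomialFamily M) (a : E) : (M a).order = -a :=
  order_eq_of_coeff (hM.coeff_ne_zero a) (hM.coeff_eq_zero a)

lemma ne_zero (hM : IsBinomialFamily M) (a : E) : M a ≠ 0 :=
  HahnSeries.ne_zero_of_coeff_ne_zero (hM.coeff_ne_zero a)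

lemma transform_coeff_order_ne_zero (hM : IsBinomialFamily M) {f : ArtinianOp E} (hf : f ≠ 0) :
    (hM.transform f).coeff f.order ≠ 0 := by
  have h := HahnSeries.coeff_mul_order_add_order f (M f.order)
  rw [hM.order_eq, add_neg_cancel] at h
  rw [transform_coeff, h]
  exact mul_ne_zero (HahnSeries.leadingCoeff_ne_zero.2 hf)
    (HahnSeries.leadingCoeff_ne_zero.2 (hM.ne_zero _))

lemma transform_order (hM : IsBinomialFamily M) (f : ArtinianOp E) :
    (hM.transform f).order = f.order := by
  rcases eq_or_ne f 0 with rfl | hf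
  · simp
  · refine order_eq_of_coeff (hM.transform_coeff_order_ne_zero hf) fun b hb => ?_
    rw [transform_coeff, HahnSeries.coeff_eq_zero_of_lt_order]
    rw [HahnSeries.order_mul hf (hM.ne_zero b), hM.order_eq]
    exact sub_eq_add_neg f.order b ▸ sub_pos.2 hb

lemma transform_injective (hM : IsBinomialFamily M) : Function.Injective hM.transform := by
  refine (injective_iff_map_eq_zero _).2 fun f hf => ?_
  by_contra h
  exact hM.transform_coeff_order_ne_zero h (by rw [hf]; rfl)

variable {Q : ArtinianOp E →ₗ[ℂ] ArtinianOp E}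

/-- `transform` intertwines an operator which shifts the family with `D⁻¹` times the Euler
operator. -/
lemma transform_apply (hM : IsBinomialFamily M)
    (hQ : ∀ f a, (Q f * M a).coeff 0 = (expC a + 1) * (f * M (a + 1)).coeff 0)
    (f : ArtinianOp E) :
    hM.transform (Q f) = HahnSeries.single (-1) 1 * euler (hM.transform f) := by
  ext a
  rw [transform_coeff, hQ, HahnSeries.coeff_single_mul, euler_coeff, sub_neg_eq_add,
    transform_coeff, one_mul, expC_add, expC_one]

/-- The Leibniz rule for `d/dD` pulls back along the injective homomorphism `transform`. -/
lemma apply_mul (hM : IsBinomialFamily M)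
    (hQ : ∀ f a, (Q f * M a).coeff 0 = (expC a + 1) * (f * M (a + 1)).coeff 0)
    (f g : ArtinianOp E) : Q (f * g) = Q f * g + f * Q g := by
  refine hM.transform_injective ?_
  rw [map_add, hM.transform_mul, hM.transform_mul, hM.transform_apply hQ, hM.transform_apply hQ,
    hM.transform_apply hQ, hM.transform_mul, euler_mul]
  ring

lemma apply_single_one_order (hM : IsBinomialFamily M)
    (hQ : ∀ f a, (Q f * M a).coeff 0 = (expC a + 1) * (f * M (a + 1)).coeff 0) :
    Q (HahnSeries.single 1 1) ≠ 0 ∧ (Q (HahnSeries.single 1 1)).order = 0 := by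
  have h0 : (HahnSeries.single 1 1 : ArtinianOp E) ≠ 0 := HahnSeries.single_ne_zero one_ne_zero
  have h1 : (hM.transform (HahnSeries.single 1 1)).order = 1 := by
    rw [hM.transform_order, HahnSeries.order_single one_ne_zero]
  have h2 : IsDelta (hM.transform (HahnSeries.single 1 1)) := by
    refine ⟨?_, fun b hb => HahnSeries.coeff_eq_zero_of_lt_order (hb.trans_eq h1.symm)⟩
    have := hM.transform_coeff_order_ne_zero h0
    rwa [HahnSeries.order_single one_ne_zero] at this
  have h3 : (HahnSeries.single (-1) 1 : ArtinianOp E) ≠ 0 := HahnSeries.single_ne_zero one_ne_zero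
  have h4 := hM.transform_apply hQ (HahnSeries.single 1 1)
  constructor
  · intro h
    rw [h, map_zero] at h4
    exact mul_ne_zero h3 h2.euler.ne_zero h4.symm
  · rw [← hM.transform_order, h4, HahnSeries.order_mul h3 h2.euler.ne_zero, h2.euler.order_eq,
      HahnSeries.order_single one_ne_zero, neg_add_cancel]

end IsBinomialFamily

/-! ### The power rule for integer exponents -/

/-- The logarithmic derivative `a ↦ Q(D^a) D^{-a}` is additive by the Leibniz rule, and an additive
map on `ℤ` is determined by its value at `1`. -/
lemma IsBinomialFamily.apply_single_int {M : ℤ → ArtinianOp ℤ} (hM : IsBinomialFamily M)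
    {Q : ArtinianOp ℤ →ₗ[ℂ] ArtinianOp ℤ}
    (hQ : ∀ f a, (Q f * M a).coeff 0 = (expC a + 1) * (f * M (a + 1)).coeff 0) (a : ℤ) :
    Q (HahnSeries.single a 1) = expC a • (Q (HahnSeries.single 1 1) * HahnSeries.single (-1) 1 *
      HahnSeries.single a 1) := by
  let l : ℤ →+ ArtinianOp ℤ := AddMonoidHom.mk' (fun a =>
    Q (HahnSeries.single a 1) * HahnSeries.single (-a) 1) fun a b => by
      have h : (HahnSeries.single (a + b) 1 : ArtinianOp ℤ) =
        HahnSeries.single a 1 * HahnSeries.single b 1 := by simp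
      have ha : (HahnSeries.single a 1 * HahnSeries.single (-a) 1 : ArtinianOp ℤ) = 1 := by simp
      have hb : (HahnSeries.single b 1 * HahnSeries.single (-b) 1 : ArtinianOp ℤ) = 1 := by simp
      have h' : (HahnSeries.single (-(a + b)) 1 : ArtinianOp ℤ) =
        HahnSeries.single (-a) 1 * HahnSeries.single (-b) 1 := by simp [add_comm]
      rw [h, hM.apply_mul hQ, h']
      linear_combination (Q (HahnSeries.single a 1) * HahnSeries.single (-a) 1) * hb +
        (Q (HahnSeries.single b 1) * HahnSeries.single (-b) 1) * ha
  have h1 : l a = a • l 1 := by rw [← map_zsmul]; simp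
  have h2 : a • l 1 = expC a • l 1 := by
    have h3 : (HahnSeries.C (expC a) : ArtinianOp ℤ) = a := by simp [expC]
    rw [zsmul_eq_mul, ← HahnSeries.C_mul_eq_smul, h3]
  have ha : (HahnSeries.single (-a) 1 * HahnSeries.single a 1 : ArtinianOp ℤ) = 1 := by simp
  calc Q (HahnSeries.single a 1) = l a * HahnSeries.single a 1 := by
        change _ = Q (HahnSeries.single a 1) * HahnSeries.single (-a) 1 * HahnSeries.single a 1
        rw [mul_assoc, ha, mul_one]
    _ = _ := by
        rw [h1, h2, smul_mul_hahn]
        rfl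

end Binomial

/-! ### The power rule for real exponents -/

section UnitSeries

variable {E : Type} [CommRing E] [LinearOrder E] [IsStrictOrderedRing E] [Algebra E ℝ]

/-- Series of degree zero with constant term one. -/
def unitSeries (E : Type) [CommRing E] [LinearOrder E] [IsStrictOrderedRing E] :
    Submonoid (ArtinianOp E) where
  carrier := {z | 0 < (z - 1).orderTop}
  one_mem' := by simp
  mul_mem' {x y} hx hy := by
    rw [Set.mem_ofPred_eq, HahnSeries.orderTop_self_sub_one_pos_iff] at *
    rw [HahnSeries.orderTop_mul, HahnSeries.leadingCoeff_mul, hx.1, hx.2, hy.1, hy.2]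
    simp

lemma mem_unitSeries_iff {z : ArtinianOp E} :
    z ∈ unitSeries E ↔ z.orderTop = 0 ∧ z.leadingCoeff = 1 :=
  HahnSeries.orderTop_self_sub_one_pos_iff z

lemma mem_unitSeries_of_coeff {z : ArtinianOp E} (h : z.coeff 0 = 1)
    (h' : ∀ b < 0, z.coeff b = 0) : z ∈ unitSeries E := by
  have h0 : z.coeff 0 ≠ 0 := by rw [h]; exact one_ne_zero
  have h1 := order_eq_of_coeff h0 h'
  rw [mem_unitSeries_iff, ← HahnSeries.order_eq_orderTop_of_ne_zero
    (HahnSeries.ne_zero_of_coeff_ne_zero h0), HahnSeries.leadingCoeff_eq, h1]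
  exact ⟨rfl, h⟩

lemma coeff_zero_of_mem_unitSeries {z : ArtinianOp E} (hz : z ∈ unitSeries E) : z.coeff 0 = 1 := by
  have h : (z - 1).coeff 0 = 0 := HahnSeries.coeff_eq_zero_of_lt_orderTop hz
  rwa [HahnSeries.coeff_sub, HahnSeries.coeff_one, if_pos rfl, sub_eq_zero] at h

/-- In `z^q - 1 = (1 + z + ⋯ + z^{q-1})(z - 1)` the first factor has constant term `q ≠ 0`. -/
lemma eq_one_of_pow_eq_one {z : ArtinianOp E} (hz : z ∈ unitSeries E) {q : ℕ} (hq : q ≠ 0)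
    (h : z ^ q = 1) : z = 1 := by
  have h1 := geom_sum_mul z q
  rw [h, sub_self] at h1
  refine sub_eq_zero.1 ((mul_eq_zero.1 h1).resolve_left fun h2 => hq ?_)
  have h3 : (∑ i ∈ Finset.range q, z ^ i).coeff 0 = q := by
    rw [HahnSeries.coeff_sum, Finset.sum_congr rfl fun i _ =>
      coeff_zero_of_mem_unitSeries (pow_mem hz i)]
    simp
  rw [h2, HahnSeries.coeff_zero] at h3
  exact_mod_cast h3.symm

lemma binPow_mem_unitSeries {u : ArtinianOp E} (hu : 0 < u.orderTop) (a : E) :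
    binPow u a ∈ unitSeries E :=
  mem_unitSeries_of_coeff (binPow_coeff_zero u a) fun _ hb => by_contra fun h =>
    (powSupport_nonneg hu (support_binPow_subset hu a h)).not_gt hb

end UnitSeries

/-- A one-parameter group of series with constant term one and with continuous coefficients
consists of binomial powers. -/
lemma eq_binPow_of_continuous {w : ℝ → ArtinianOp ℝ} (hw : ∀ x, w x ∈ unitSeries ℝ)
    (hadd : ∀ x y, w (x + y) = w x * w y) (hcont : ∀ s, Continuous fun x => (w x).coeff s)
    (x : ℝ) : w x = binPow (w 1 - 1) x := by
  have hu : 0 < (w 1 - 1).orderTop := hw 1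
  have hw0 : w 0 = 1 := by
    have h := hadd 0 0
    rw [add_zero] at h
    have h0 : w 0 ≠ 0 := fun h0 => by
      have := coeff_zero_of_mem_unitSeries (hw 0)
      simp [h0] at this
    exact (mul_left_cancel₀ h0 (h.symm.trans (mul_one _).symm))
  -- The quotient of the two one-parameter groups. It is trivial at `1`, hence at every rational
  -- because the unit series have no torsion, and density of `ℚ` finishes the proof coefficientwise.
  let C : Multiplicative ℝ →* ArtinianOp ℝ :=
    { toFun := fun x => w x.toAdd * binPow (w 1 - 1) (-x.toAdd)
      map_one' := by simp [hw0]
      map_mul' := fun x y => by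
        rw [toAdd_mul, hadd, neg_add, binPow_add]
        ring }
  have hC : ∀ x : ℝ, C (Multiplicative.ofAdd x) = w x * binPow (w 1 - 1) (-x) := fun x => rfl
  have hC1 : C (Multiplicative.ofAdd 1) = 1 := by
    have h : w 1 = binPow (w 1 - 1) 1 := by rw [binPow_one hu, add_sub_cancel]
    rw [hC]
    nth_rewrite 1 [h]
    rw [← binPow_add, add_neg_cancel, binPow_zero]
  have hCq : ∀ r : ℚ, C (Multiplicative.ofAdd (r : ℝ)) = 1 := by
    intro r
    refine eq_one_of_pow_eq_one (mul_mem (hw _) (binPow_mem_unitSeries hu _)) r.den_ne_zero ?_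
    rw [← map_pow, ← ofAdd_nsmul]
    have h : (r.den • (r : ℝ)) = r.num • (1 : ℝ) := by
      rw [nsmul_eq_mul, zsmul_eq_mul, mul_one]
      exact_mod_cast Rat.den_mul_eq_num r
    rw [h, ofAdd_zsmul]
    have h1 : ∀ n : ℕ, C (Multiplicative.ofAdd 1 ^ n) = 1 := fun n => by rw [map_pow, hC1, one_pow]
    rcases Int.eq_nat_or_neg r.num with ⟨n, hn | hn⟩
    · rw [hn, zpow_natCast, h1]
    · have h2 := map_mul C (Multiplicative.ofAdd 1 ^ (-(n : ℤ))) (Multiplicative.ofAdd 1 ^ n)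
      rw [h1, mul_one, ← zpow_natCast, ← zpow_add, neg_add_cancel, zpow_zero, map_one] at h2
      rw [hn, ← h2]
  have hq : ∀ r : ℚ, w r = binPow (w 1 - 1) (r : ℝ) := fun r => by
    have h := hCq r
    rw [hC] at h
    calc w r = w r * binPow (w 1 - 1) (-(r : ℝ)) * binPow (w 1 - 1) (r : ℝ) := by
          rw [mul_assoc, ← binPow_add, neg_add_cancel, binPow_zero, mul_one]
      _ = _ := by rw [h, one_mul]
  ext s
  have hE : Continuous (expC : ℝ → ℂ) := Complex.continuous_ofReal
  have h := Rat.denseRange_cast (𝕜 := ℝ) |>.equalizer (hcont s)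
    (continuous_binPow_coeff hu s (φ := id) hE) (funext fun r => by
      simp only [Function.comp_apply, id, hq])
  exact congrFun h x

/-! ### Transforms of the real powers of `D` -/

namespace IsBinomialFamily

variable {M : ℝ → ArtinianOp ℝ} {Q : ArtinianOp ℝ →ₗ[ℂ] ArtinianOp ℝ}

/-- The transforms of the `D^x` form a multiplicative one-parameter family. Dividing by the leading
monomials leaves unit series with continuous coefficients, to which `eq_binPow_of_continuous`
applies. -/
lemma exists_transform_single (hM : IsBinomialFamily M)
    (hcont : ∀ s, Continuous fun a => (M a).coeff (s - a)) :
    ∃ (m : ℝ → ℂ) (u : ArtinianOp ℝ), 0 < u.orderTop ∧ (∀ x y, m (x + y) = m x * m y) ∧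
      ∀ x, hM.transform (HahnSeries.single x 1) = HahnSeries.single x (m x) * binPow u x := by
  let G (x : ℝ) := hM.transform (HahnSeries.single x 1)
  let m (x : ℝ) : ℂ := (M x).coeff (-x)
  have hm0 : ∀ x, m x ≠ 0 := hM.coeff_ne_zero
  have hGc : ∀ x a, (G x).coeff a = (M a).coeff (-x) := fun x a => by
    simp [G, transform_coeff, HahnSeries.coeff_single_mul]
  have hGadd : ∀ x y, G (x + y) = G x * G y := fun x y => by
    simp only [G]
    rw [← hM.transform_mul, HahnSeries.single_mul_single, one_mul]
  have hord : ∀ x, (G x).order = x := fun x => by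
    rw [hM.transform_order, HahnSeries.order_single one_ne_zero]
  have hGm : ∀ x, (G x).leadingCoeff = m x := fun x => by
    rw [HahnSeries.leadingCoeff_eq, hord, hGc]
  have hmadd : ∀ x y, m (x + y) = m x * m y := fun x y => by
    rw [← hGm, hGadd, HahnSeries.leadingCoeff_mul, hGm, hGm]
  let w (x : ℝ) : ArtinianOp ℝ := HahnSeries.single (-x) (m x)⁻¹ * G x
  have hwc : ∀ x s, (w x).coeff s = (m x)⁻¹ * (M (s + x)).coeff (-x) := fun x s => by
    simp only [w]
    rw [HahnSeries.coeff_single_mul, sub_neg_eq_add, hGc]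
  have hGw : ∀ x, G x = HahnSeries.single x (m x) * w x := fun x => by
    simp only [w]
    rw [← mul_assoc, HahnSeries.single_mul_single, add_neg_cancel, mul_inv_cancel₀ (hm0 x),
      HahnSeries.single_zero_one, one_mul]
  have hw : ∀ x, w x ∈ unitSeries ℝ := fun x => by
    refine mem_unitSeries_of_coeff ?_ fun b hb => ?_
    · rw [hwc, zero_add]
      exact inv_mul_cancel₀ (hm0 x)
    · rw [hwc, hM.coeff_eq_zero _ _ (by linarith), mul_zero]
  have hwadd : ∀ x y, w (x + y) = w x * w y := fun x y => by
    have h : (HahnSeries.single (-(x + y)) (m (x + y))⁻¹ : ArtinianOp ℝ) =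
        HahnSeries.single (-x) (m x)⁻¹ * HahnSeries.single (-y) (m y)⁻¹ := by
      rw [HahnSeries.single_mul_single, neg_add, hmadd, mul_inv]
    simp only [w]
    rw [h, hGadd]
    ring
  -- The hypothesis at `a = s + x`, since `s - (s + x) = -x`.
  have hcont' : ∀ s, Continuous fun x => (M (s + x)).coeff (-x) := fun s => by
    have h := (hcont s).comp (continuous_const_add s)
    refine h.congr fun x => ?_
    simp
  have hwcont : ∀ s, Continuous fun x => (w x).coeff s := fun s => by
    simp_rw [hwc]
    refine Continuous.mul (Continuous.inv₀ ?_ hm0) (hcont' s)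
    simpa [m] using hcont' 0
  refine ⟨m, w 1 - 1, hw 1, hmadd, fun x => ?_⟩
  rw [← eq_binPow_of_continuous hw hwadd hwcont]
  exact hGw x

/-- After applying `transform`, both sides are explicit. The leading scalars matter only through `m
a = m 1 * m (a - 1)`. -/
lemma apply_single_real (hM : IsBinomialFamily M)
    (hcont : ∀ s, Continuous fun a => (M a).coeff (s - a))
    (hQ : ∀ f a, (Q f * M a).coeff 0 = (expC a + 1) * (f * M (a + 1)).coeff 0) (a : ℝ) :
    Q (HahnSeries.single a 1) = expC a • (Q (HahnSeries.single 1 1) * HahnSeries.single (-1) 1 *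
      HahnSeries.single a 1) := by
  obtain ⟨m, u, hu, hm, hG⟩ := hM.exists_transform_single hcont
  have hE : ∀ x, euler (hM.transform (HahnSeries.single x 1)) =
      expC x • (HahnSeries.single x (m x) * binPow u (x - 1) * (1 + u + euler u)) := fun x => by
    have h : binPow u x = binPow u (x - 1) * (1 + u) := by
      rw [← binPow_one hu, ← binPow_add, sub_add_cancel]
    rw [hG, euler_mul, euler_single, euler_binPow hu, h]
    simp only [← HahnSeries.C_mul_eq_smul]
    ring
  have h1 : (HahnSeries.single a (m a) : ArtinianOp ℝ) =
      HahnSeries.single 1 (m 1) * HahnSeries.single (a - 1) (m (a - 1)) := by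
    rw [HahnSeries.single_mul_single, ← hm, add_sub_cancel]
  refine hM.transform_injective ?_
  rw [map_smul, mul_assoc, HahnSeries.single_mul_single, one_mul, neg_add_eq_sub,
    hM.transform_mul, hM.transform_apply hQ, hM.transform_apply hQ, hE, hE, hG, h1, sub_self,
    binPow_zero, expC_one]
  simp only [← HahnSeries.C_mul_eq_smul, map_one]
  ring

end IsBinomialFamily

section Forward

variable {E : Type} [CommRing E] [LinearOrder E] [IsStrictOrderedRing E] [Algebra E ℝ]
  {J : Set LogIndex} {θ : LogSum E J →ₗ[ℂ] LogSum E J} {β : J}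

/-! ### Roman shifts have derivations as adjoints -/

/-- The Artinian operator corresponding to the series `p / ⌊a⌉!`. -/
def normalized (a : E) (p : HahnSeries Eᵒᵈ ℂ) : ArtinianOp E := (romanFactorial a)⁻¹ • toArtinian p

lemma pairing_eq_normalized (f : ArtinianOp E) (a : E) (p : HahnSeries Eᵒᵈ ℂ) :
    pairing f p = romanFactorial a * (f * normalized a p).coeff 0 := by
  rw [normalized, mul_smul_hahn, HahnSeries.coeff_smul, smul_eq_mul,
    mul_inv_cancel_left₀ (romanFactorial_ne_zero a), pairing_apply]

lemma normalized_coeff (a : E) (p : HahnSeries Eᵒᵈ ℂ) (c : E) :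
    (normalized a p).coeff c =
      (romanFactorial a)⁻¹ * (romanFactorial (-c) * p.coeff (OrderDual.toDual (-c))) := rfl

lemma IsRomanSequence.isBinomialFamily [TopologicalSpace E] {p : (α : J) → E → LogSpace E α.1}
    (hp : IsRomanSequence p) (hβ : β.1 ≠ 0) :
    IsBinomialFamily fun a => normalized a (p β a).1 := by
  have haug : ∀ (g : ArtinianOp E) (a : E), aug (actLog g hβ (p β a)) =
      romanFactorial a * (g * normalized a (p β a).1).coeff 0 := fun g a => by
    rw [aug_actLog, ← pairing_apply, pairing_eq_normalized g a]
  have hterm : ∀ (g h : ArtinianOp E) (a b : E),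
      romanCoeff a b * aug (actLog g hβ (p β b)) * aug (actLog h hβ (p β (a - b))) =
      romanFactorial a * ((g * normalized b (p β b).1).coeff 0 *
        (h * normalized (a - b) (p β (a - b)).1).coeff 0) := by
    intro g h a b
    rw [haug, haug, romanCoeff]
    have h1 := romanFactorial_ne_zero b
    have h2 := romanFactorial_ne_zero (a - b)
    field_simp
  refine ⟨fun a => ?_, fun a c hc => ?_, fun f g a => ?_, fun f g a => ?_⟩
  · rw [normalized_coeff, neg_neg]
    exact mul_ne_zero (inv_ne_zero (romanFactorial_ne_zero a)) (mul_ne_zero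
      (romanFactorial_ne_zero a) (hp.graded.degree β a fun h => hβ h.1).1)
  · rw [normalized_coeff]
    have h := (hp.graded.degree β a fun h => hβ h.1).2 (-c) (lt_neg.1 hc)
    rw [lcoeff] at h
    rw [h, mul_zero, mul_zero]
  · have h := hp.finite_support β hβ f g a
    simp_rw [hterm] at h
    exact h.subset fun b hb => mul_ne_zero (romanFactorial_ne_zero a) hb
  · have h := hp.binomial β hβ f g a
    simp_rw [hterm] at h
    rw [haug, ← mul_finsum] at h
    exact mul_left_cancel₀ (romanFactorial_ne_zero a) h

lemma IsGradedSequence.continuous_normalized [TopologicalSpace E]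
    {p : (α : J) → E → LogSpace E α.1} (hp : IsGradedSequence p) (hβ : β.1 ≠ 0) (s : E) :
    Continuous fun a => (normalized a (p β a).1).coeff (s - a) := by
  refine (hp.continuous β hβ s).congr fun a => ?_
  rw [normalized_coeff, neg_sub, lcoeff]
  ring

open Classical in
lemma baseOp_apply_of_shift {p : (α : J) → E → LogSpace E α.1}
    (hshift : ∀ (α : J) (a : E), θ (DirectSum.lof ℂ J (fun α => LogSpace E α.1) α (p α a)) =
      if a = -1 then 0 else DirectSum.lof ℂ J (fun α => LogSpace E α.1) α (p α (a + 1)))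
    (a : E) : baseOp θ β (p β a).1 = if a = -1 then 0 else (p β (a + 1)).1 := by
  rw [baseOp, LinearMap.comp_apply, LinearMap.comp_apply, relabel_self, component,
    LinearMap.comp_apply, LinearMap.comp_apply, hshift]
  split_ifs
  · rw [map_zero, map_zero]
  · rw [DirectSum.component.lof_self]
    rfl

/-- The power rule for the adjoints of Roman shifts. -/
def HasPowerRule (E : Type) [CommRing E] [LinearOrder E] [IsStrictOrderedRing E] [Algebra E ℝ]
    [TopologicalSpace E] : Prop :=
  ∀ (M : E → ArtinianOp E) (Q : ArtinianOp E →ₗ[ℂ] ArtinianOp E), IsBinomialFamily M →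
    (∀ s, Continuous fun a => (M a).coeff (s - a)) →
    (∀ f a, (Q f * M a).coeff 0 = (expC a + 1) * (f * M (a + 1)).coeff 0) →
    ∀ a, Q (HahnSeries.single a 1) = expC a • (Q (HahnSeries.single 1 1) *
      HahnSeries.single (-1) 1 * HahnSeries.single a 1)

lemma isContinuousArtinianDerivation_of_eq {L : Subring (ArtinianOp E)}
    {Q : ArtinianOp E →ₗ[ℂ] ArtinianOp E} {q : ArtinianOp E} (hQ : ∀ f, Q f = q * euler f)
    (hL : ∀ f ∈ L, Q f ∈ L) : IsContinuousArtinianDerivation L Q := by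
  refine ⟨hL, ?_, fun f _ g _ hf hg a b n m => ?_⟩
  · let t : TopologicalSpace (ArtinianOp E) := seriesTopology E
    exact Continuous.comp (g := Q) (continuous_mul_euler q hQ)
      (continuous_induced_dom (f := Subtype.val) (t := t))
  · rw [hQ, hQ, hQ, euler_mul, euler_artPow hf, euler_artPow hg]
    simp only [← HahnSeries.C_mul_eq_smul]
    ring

/-! ### Inverses and Euler antiderivatives -/

lemma inv_mem_differentialOps {f : ArtinianOp E} (hf : f ∈ differentialOps E)
    (h0 : f.coeff 0 ≠ 0) : f⁻¹ ∈ differentialOps E := by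
  obtain ⟨p, rfl⟩ := hf
  have h1 : PowerSeries.constantCoeff p ≠ 0 := by
    rw [← PowerSeries.coeff_zero_eq_constantCoeff_apply]
    have h2 := HahnSeries.ofPowerSeries_apply_coeff (Γ := E) p 0
    rw [Nat.cast_zero] at h2
    rwa [h2] at h0
  refine ⟨p⁻¹, eq_inv_of_mul_eq_one_left ?_⟩
  rw [← map_mul, PowerSeries.inv_mul_cancel _ h1, map_one]

/-- The antiderivative of the Euler operator. -/
def eulerInv (f : ArtinianOp E) : ArtinianOp E where
  coeff a := (expC a)⁻¹ * f.coeff a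
  isPWO_support' := f.isPWO_support.mono fun _ ha => right_ne_zero_of_mul ha

lemma eulerInv_coeff (f : ArtinianOp E) (a : E) :
    (eulerInv f).coeff a = (expC a)⁻¹ * f.coeff a := rfl

lemma euler_eulerInv [FaithfulSMul E ℝ] {f : ArtinianOp E} (hf : f.coeff 0 = 0) :
    euler (eulerInv f) = f := by
  ext a
  rw [euler_coeff, eulerInv_coeff]
  rcases eq_or_ne a 0 with rfl | ha
  · simp [hf]
  · rw [mul_inv_cancel_left₀ fun h => ha (expC_eq_zero.1 h)]

/-- Because `λ_{-1}` is zero in `I^(0)`, regularity forces the underlying operator to send it to a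
series in the `λ_b` with `b` a negative integer. The adjoint relation turns this into a restriction
on the exponents of `Q(D)`. -/
lemma apply_single_one_mem_differentialOps [FaithfulSMul E ℝ] (hθ : IsRegularOperator θ)
    (hβ : β.1 ≠ 0) {α : J} (hα : α.1 = 0) {Q : ArtinianOp E →ₗ[ℂ] ArtinianOp E}
    (hadj : ∀ f p, pairing (Q f) p = pairing f (baseOp θ β p))
    (hpow : ∀ a, Q (HahnSeries.single a 1) = expC a • (Q (HahnSeries.single 1 1) *
      HahnSeries.single (-1) 1 * HahnSeries.single a 1)) :
    Q (HahnSeries.single 1 1) ∈ differentialOps E := by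
  have hmem : ∀ b, (baseOp θ β (ofArtinian (HahnSeries.single 1 1))).coeff (OrderDual.toDual b) ≠ 0
      → IsNegInt b := by
    intro b hb
    by_contra hneg
    have h0 : relabel α.1 (ofArtinian (HahnSeries.single 1 1) : HahnSeries Eᵒᵈ ℂ) = 0 := by
      refine Subtype.ext (HahnSeries.ext (funext fun c => ?_))
      change lcoeff (relabel α.1 _) (OrderDual.ofDual c) = 0
      by_cases hc : IsNegInt (OrderDual.ofDual c)
      · rw [hα, lcoeff_relabel_zero _ hc]
      · refine lcoeff_relabel_eq_zero ?_
        rw [ofArtinian_coeff, HahnSeries.coeff_single_of_ne, zero_div]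
        intro h
        exact hc ⟨0, by rw [Nat.cast_zero, zero_add]; exact neg_eq_iff_eq_neg.1 h⟩
    have h1 := hθ.apply_lof_relabel hβ α (ofArtinian (HahnSeries.single 1 1))
    rw [h0, map_zero, map_zero] at h1
    have h2 := congrArg (DirectSum.component ℂ J (fun α => LogSpace E α.1) α) h1
    rw [DirectSum.component.lof_self, map_zero] at h2
    refine hb ?_
    rw [← lcoeff_relabel (α := α.1) _ fun h => hneg h.2, ← h2]
    rfl
  refine mem_differentialOps_iff.2 fun s hs => ?_
  rcases eq_or_ne s 0 with rfl | hs0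
  · exact ⟨0, by simp⟩
  -- Pairing `D^{-s}` with the image of `λ_{-1}` isolates `-s` times the coefficient of `Q(D)` at
  -- `s`; hence `s = 0` was treated separately.
  have h := hadj (HahnSeries.single (-s) 1) (ofArtinian (HahnSeries.single 1 1))
  rw [pairing_apply, pairing_apply, toArtinian_ofArtinian, hpow, smul_mul_hahn,
    HahnSeries.coeff_smul, mul_assoc, mul_assoc, HahnSeries.single_mul_single,
    HahnSeries.single_mul_single, HahnSeries.coeff_mul_single, HahnSeries.coeff_single_mul,
    toArtinian_coeff] at h
  have h3 : (0 : E) - (-1 + (-s + 1)) = s := by ring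
  have h4 : -((0 : E) - -s) = -s := by ring
  rw [h3, h4] at h
  have h5 : expC (-s) ≠ 0 := fun h => hs0 (neg_eq_zero.1 (expC_eq_zero.1 h))
  obtain ⟨n, hn⟩ := hmem (-s) fun h0 => by
    rw [h0, mul_zero, mul_zero] at h
    exact mul_ne_zero h5 (mul_ne_zero hs (by simp)) h
  exact ⟨n + 1, by push_cast; exact neg_injective hn⟩

lemma exists_derivation_of_isRomanShift [FaithfulSMul E ℝ] [TopologicalSpace E]
    (hE : HasPowerRule E) (hθ : IsRegularOperator θ) (hcont : IsContinuousOperator θ)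
    (hβ : β.1 ≠ 0) {L : Subring (ArtinianOp E)}
    (hL : L = ⊤ ∨ L = differentialOps E ∧ ∃ α : J, α.1 = 0) (hshift : IsRomanShift θ) :
    ∃ Q : ArtinianOp E →ₗ[ℂ] ArtinianOp E, IsAdjoint θ Q ∧
      IsContinuousArtinianDerivation L Q ∧ ∃ f ∈ L, IsDelta f ∧ Q f = 1 := by
  obtain ⟨p, hp, hshift⟩ := hshift
  obtain ⟨Q, hadj⟩ := exists_adjoint (hcont.continuous_baseOp hβ)
  have hM := hp.isBinomialFamily hβ
  -- Division by the Roman factorials absorbs the exceptional case: at `a = -1` the factor `a + 1`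
  -- is zero.
  have hQ : ∀ f a, (Q f * normalized a (p β a).1).coeff 0 =
      (expC a + 1) * (f * normalized (a + 1) (p β (a + 1)).1).coeff 0 := by
    intro f a
    have h := hadj f (p β a).1
    rw [pairing_eq_normalized _ a, baseOp_apply_of_shift hshift] at h
    refine mul_left_cancel₀ (romanFactorial_ne_zero a) (h.trans ?_)
    split_ifs with ha
    · simp [ha]
    · rw [pairing_eq_normalized _ (a + 1), romanFactorial_add_one ha]
      ring
  have hpow := hE _ Q hM (hp.graded.continuous_normalized hβ) hQ
  obtain ⟨hne, hord⟩ := hM.apply_single_one_order hQ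
  set d := Q (HahnSeries.single 1 1) with hd
  have hQeq : ∀ f, Q f = d * HahnSeries.single (-1) 1 * euler f := adjoint_eq_mul_euler hadj hpow
  have hd0 : d.coeff 0 ≠ 0 := by
    rw [← hord, ← HahnSeries.leadingCoeff_eq]
    exact HahnSeries.leadingCoeff_ne_zero.2 hne
  have hinv : d⁻¹ ≠ 0 := inv_ne_zero hne
  have hinvord : (d⁻¹).order = 0 := by
    have h := HahnSeries.order_mul hne hinv
    rw [mul_inv_cancel₀ hne, HahnSeries.order_one, hord, zero_add] at h
    exact h.symm
  -- `r` is the inverse of `q = d D⁻¹`. It has degree one, so it has no constant term and is the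
  -- Euler derivative of a delta operator.
  set r := HahnSeries.single 1 1 * d⁻¹ with hr
  have hrc : ∀ c, r.coeff c = (d⁻¹).coeff (c - 1) := fun c => by
    rw [hr, HahnSeries.coeff_single_mul, one_mul]
  have hr0 : ∀ c < 1, r.coeff c = 0 := fun c hc => by
    rw [hrc]
    exact HahnSeries.coeff_eq_zero_of_lt_order (by rw [hinvord]; exact sub_neg.2 hc)
  have hr1 : r.coeff 1 ≠ 0 := by
    rw [hrc, sub_self, ← hinvord, ← HahnSeries.leadingCoeff_eq]
    exact HahnSeries.leadingCoeff_ne_zero.2 hinv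
  have hmem : L = differentialOps E → d ∈ differentialOps E := by
    rintro rfl
    rcases hL with hL | ⟨-, α, hα⟩
    · rw [hL]
      trivial
    · exact apply_single_one_mem_differentialOps hθ hβ hα hadj hpow
  have hQL : ∀ f ∈ L, Q f ∈ L := by
    intro f hf
    rcases hL with rfl | ⟨rfl, -⟩
    · trivial
    · rw [hQeq, mul_assoc]
      refine mul_mem (hmem rfl) (mem_differentialOps_iff.2 fun c hc => ?_)
      rw [HahnSeries.coeff_single_mul, euler_coeff, one_mul, sub_neg_eq_add] at hc
      obtain ⟨n, hn⟩ := mem_differentialOps_iff.1 hf _ (right_ne_zero_of_mul hc)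
      -- `D⁻¹ euler` preserves `Λ` because the Euler operator kills the constant term, the only one
      -- that `D⁻¹` would move out of `Λ`.
      rcases n with _ | n
      · rw [hn, Nat.cast_zero, expC_zero, zero_mul] at hc
        exact absurd rfl hc
      · exact ⟨n, by push_cast at hn; exact add_right_cancel hn⟩
  refine ⟨Q, (hθ.isAdjoint_iff hβ Q).2 hadj, isContinuousArtinianDerivation_of_eq hQeq hQL,
    eulerInv r, ?_, ⟨?_, fun c hc => ?_⟩, ?_⟩
  · rcases hL with rfl | ⟨rfl, -⟩
    · trivial
    · refine mem_differentialOps_iff.2 fun c hc => ?_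
      exact mem_differentialOps_iff.1 (mul_mem single_one_mem_differentialOps
        (inv_mem_differentialOps (hmem rfl) hd0)) c (right_ne_zero_of_mul hc)
  · rw [eulerInv_coeff, expC_one, inv_one, one_mul]
    exact hr1
  · rw [eulerInv_coeff, hr0 c hc, mul_zero]
  · have h1 : (HahnSeries.single (-1) 1 * HahnSeries.single 1 1 : ArtinianOp E) = 1 := by simp
    rw [hQeq, euler_eulerInv (hr0 0 zero_lt_one), hr]
    calc d * HahnSeries.single (-1) 1 * (HahnSeries.single 1 1 * d⁻¹) =
        d * d⁻¹ * (HahnSeries.single (-1) 1 * HahnSeries.single 1 1) := by ring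
      _ = 1 := by rw [h1, mul_inv_cancel₀ hne, mul_one]

/-- Roman shifts are characterized by their adjoints. -/
theorem isRomanShift_iff [FaithfulSMul E ℝ] [TopologicalSpace E]
    (hE : Continuous (expC : E → ℂ)) (hpow : HasPowerRule E) (hβ : β.1 ≠ 0)
    {L : Subring (ArtinianOp E)} (hL : L = ⊤ ∧ (∀ α : J, α.1 ≠ 0) ∨
      L = differentialOps E ∧ ∃ α : J, α.1 = 0)
    (hθ : IsRegularOperator θ) (hcont : IsContinuousOperator θ) :
    IsRomanShift θ ↔ ∃ Q : ArtinianOp E →ₗ[ℂ] ArtinianOp E, IsAdjoint θ Q ∧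
      IsContinuousArtinianDerivation L Q ∧ ∃ f ∈ L, IsDelta f ∧ Q f = 1 := by
  refine ⟨exists_derivation_of_isRomanShift hpow hθ hcont hβ (hL.imp_left And.left), ?_⟩
  rintro ⟨Q, hQ, hder, f, hf, hdelta, hQf⟩
  refine isRomanShift_of_derivation hE hθ hβ ?_ ?_ hQ hder hf hdelta hQf
  · rcases hL with ⟨rfl, -⟩ | ⟨rfl, -⟩
    · trivial
    · exact single_one_mem_differentialOps
  · rcases hL with ⟨-, h⟩ | ⟨rfl, -⟩
    · exact fun α hα => absurd hα (h α)
    · exact fun _ _ => rfl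

lemma hasPowerRule_int : HasPowerRule ℤ := fun _ _ hM _ hQ => hM.apply_single_int hQ

lemma hasPowerRule_real : HasPowerRule ℝ := fun _ _ hM hcont hQ => hM.apply_single_real hcont hQ

end Forward

end LogAlgebra

end

/-! ### The discrete and the continuous theory -/

open LogAlgebra in
theorem mainTheorem10 :
    (∀ θ : LogAlgPlus ℤ →ₗ[ℂ] LogAlgPlus ℤ, IsRegularOperator θ → IsContinuousOperator θ →
      (IsRomanShift θ ↔
        ∃ Q : ArtinianOp ℤ →ₗ[ℂ] ArtinianOp ℤ, IsAdjoint θ Q ∧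
          IsContinuousArtinianDerivation (⊤ : Subring (ArtinianOp ℤ)) Q ∧ ∃ f ∈ (⊤ : Subring (ArtinianOp ℤ)), IsDelta f ∧ Q f = 1)) ∧
    (∀ θ : LogAlg ℤ →ₗ[ℂ] LogAlg ℤ, IsRegularOperator θ → IsContinuousOperator θ →
      (IsRomanShift θ ↔
        ∃ Q : ArtinianOp ℤ →ₗ[ℂ] ArtinianOp ℤ, IsAdjoint θ Q ∧
          IsContinuousArtinianDerivation (differentialOps ℤ) Q ∧ ∃ f ∈ (differentialOps ℤ), IsDelta f ∧ Q f = 1)) ∧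
    (∀ θ : LogAlgPlus ℝ →ₗ[ℂ] LogAlgPlus ℝ, IsRegularOperator θ → IsContinuousOperator θ →
      (IsRomanShift θ ↔
        ∃ Q : ArtinianOp ℝ →ₗ[ℂ] ArtinianOp ℝ, IsAdjoint θ Q ∧
          IsContinuousArtinianDerivation (⊤ : Subring (ArtinianOp ℝ)) Q ∧ ∃ f ∈ (⊤ : Subring (ArtinianOp ℝ)), IsDelta f ∧ Q f = 1)) ∧
    (∀ θ : LogAlg ℝ →ₗ[ℂ] LogAlg ℝ, IsRegularOperator θ → IsContinuousOperator θ →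
      (IsRomanShift θ ↔
        ∃ Q : ArtinianOp ℝ →ₗ[ℂ] ArtinianOp ℝ, IsAdjoint θ Q ∧
          IsContinuousArtinianDerivation (differentialOps ℝ) Q ∧ ∃ f ∈ (differentialOps ℝ), IsDelta f ∧ Q f = 1)) := by
  have h1 : (Finsupp.single 0 1 : LogIndex) ≠ 0 := Finsupp.single_ne_zero.2 one_ne_zero
  have hZ : Continuous (expC : ℤ → ℂ) := continuous_of_discreteTopology
  have hR : Continuous (expC : ℝ → ℂ) := Complex.continuous_ofReal
  refine ⟨fun θ => ?_, fun θ => ?_, fun θ => ?_, fun θ => ?_⟩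
  · exact isRomanShift_iff (β := ⟨_, h1⟩) hZ hasPowerRule_int h1 (Or.inl ⟨rfl, fun α => α.2⟩)
  · exact isRomanShift_iff (β := ⟨_, Set.mem_univ _⟩) hZ hasPowerRule_int h1
      (Or.inr ⟨rfl, ⟨0, Set.mem_univ _⟩, rfl⟩)
  · exact isRomanShift_iff (β := ⟨_, h1⟩) hR hasPowerRule_real h1 (Or.inl ⟨rfl, fun α => α.2⟩)
  · exact isRomanShift_iff (β := ⟨_, Set.mem_univ _⟩) hR hasPowerRule_real h1
      (Or.inr ⟨rfl, ⟨0, Set.mem_univ _⟩, rfl⟩)
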